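/- **Setting.** Let $\Omega_i\subseteq\mathbb R^{d_i}$ ($i=1,2$) be open, $\Omega=\Omega_1\times\Omega_2$, and write $L^2$ for complex-valued square integrable functions, $\|\cdot\|$ for the norm of $L^2(\Omega)$. Let $\Delta_i$ be a self-adjoint realization of the Laplacian on $L^2(\Omega_i)$ (a self-adjoint operator that agrees with the Laplacian on $C_c^\infty(\Omega_i)$), and $e^{it\Delta}=e^{it\Delta_1}\otimes e^{it\Delta_2}$ on $L^2(\Omega)$. For $v\in L^2(\Omega)$, $\operatorname{rank}(v)$ is the least number $r$ such that $v$ is a sum of $r$ elementary tensors $v_1\otimes v_2$ with $v_i\in L^2(\Omega_i)$ ($\infty$ if there is none). Let $V\in L^2(\Omega)$ be nonzero, essentially bounded and of finite rank, and let $C_V$ be the norm of the operator of multiplication by $V$ on $L^2(\Omega)$. For $v\in L^2(\Omega)$ with singular value decomposition $v=\sum_{k\ge1}\sigma_k\,v^{(1)}_k\otimes v^{(2)}_k$, $\sigma_1\ge\sigma_2\ge\dots\ge0$, put $\sigma_{\max}(v)=\sigma_1$, $$\mathcal S_\alpha v=\sum_{k}\max\{\sigma_k-\alpha,0\}\,v^{(1)}_k\otimes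 v^{(2)}_k,\qquad \mathcal R_\delta v=\sum_{k\le r_\delta}\sigma_k\,v^{(1)}_k\otimes v^{(2)}_k,\qquad r_\delta=\min\Bigl\{r\in\mathbb N_0:\sum_{k>r}\sigma_k^2\le\delta^2\Bigr\}$$ (for multiple singular values, $\mathcal R_\delta v$ is formed with an arbitrary singular value decomposition of $v$). Let $J\ge1$, $h>0$, let $t_1<\dots<t_J$ be the Gauss–Legendre nodes of $[0,h]$ and $\ell_1,\dots,\ell_J$ the corresponding Lagrange polynomials, and set $$\Lambda_J=\frac1h\int_0^h\sum_{m=1}^J|\ell_m(s)|\,ds,\qquad \rho=h\,\Lambda_J\,C_V .$$ For $\mathbf v=(v_m)_{m\le J}\in L^2(\Omega)^J$ let $\|\mathbf v\|_J=\max_m\|v_m\|$, and for functions $w:[0,h]\to L^2(\Omega)$ let $\|w\|_{\mathcal W(0,h)}$ be the norm of $L^\infty(0,h;L^2(\Omega))$. Given $u_0^*\in L^2(\Omega)$, put $$\Phi\mathbf v(t)=e^{it\Delta}u_0^*-i\int_0^t\sum_{m=1}^J\ell_m(s)\,e^{i(t-t_m)\Delta}(V v_m)\,ds,\qquad \mathbf\Phi\mathbf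 v=(\Phi\mathbf v(t_j))_{1\le j\le J}.$$ Let $u$ be the (mild) solution on $[0,h]$ of $i\partial_tu=-\Delta u+Vu$ with some initial value $u(0)=u_0^\diamond\in L^2(\Omega)$, and let $u^*$ be the collocation solution with initial value $u_0^*$, that is, $u^*(t)=\Phi\bigl((u^*(t_m))_{m\le J}\bigr)(t)$ for $t\in[0,h]$. **Algorithm.** For the tolerance $\varepsilon$, let $\mathbf u^0=\mathbf 0$ and $u^{k+1}_j=\mathcal S_{\alpha_k}\bigl((\mathbf\Phi\mathbf u^k)_j\bigr)$ for $1\le j\le J$, $k\ge0$, with $\alpha_k=\rho^{k/2}\sigma_{\max}(u_0^*)$. Let $K$ be the least $k\ge0$ with $\|\mathbf\Phi\mathbf u^k-\mathbf u^k\|_J\le\varepsilon$. The approximation at the right end point of the interval is $\tilde u(h)=\mathcal R_\delta\,\Phi\mathbf u^K(h)$. **Proposition.** Assume that $\rho\le\frac12$ and $$\varepsilon\ge4\,\frac{1+\rho}{1-\rho}\,\|u-u^*\|_{\mathcal W(0,h)},\qquad \delta=\frac{\rho\,\varepsilon}{1-\rho}.$$ Let $\bar\alpha>0$ be such that $\|u-\mathcal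 S_{\bar\alpha}u\|_{\mathcal W(0,h)}=\frac{1-\rho}{1+\rho}\,\frac{\varepsilon}{4}$, and set $\bar r=\dfrac{\varepsilon^2}{\rho\,\bar\alpha^2}$. If $$\operatorname{rank}(u_0^*)\le\frac{1+J\operatorname{rank}(V)\,\bar r}{\rho^2},$$ then $$\operatorname{rank}(\tilde u(h))\le\frac{1+J\operatorname{rank}(V)\,\bar r}{\rho^2},$$ and for all $0\le k\le K$ and $1\le j\le J$, $$\operatorname{rank}(u^k_j)\le\frac{1+\rho^2}{\rho^2}\bigl(1+J\operatorname{rank}(V)\,\bar r\bigr),\qquad \operatorname{rank}\bigl((\mathbf\Phi\mathbf u^k)_j\bigr)\le\frac{1+\rho^2}{\rho^2}\bigl(1+J\operatorname{rank}(V)\,\bar r\bigr).$$ -/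

import Mathlib

open MeasureTheory TensorProduct
open scoped ENNReal InnerProductSpace

namespace LowRank

set_option linter.unusedSectionVars false

/-! ### Existence of singular value decompositions, abstract form -/

section Abstract
variable {H G P : Type*} [NormedAddCommGroup H] [InnerProductSpace ℂ H] [CompleteSpace H]
  [NormedAddCommGroup G] [InnerProductSpace ℂ G] [CompleteSpace G]
  [NormedAddCommGroup P] [InnerProductSpace ℂ P] [CompleteSpace P]

/-- The antilinear operator `a ↦ ⟨a ⊗ ·, v⟩` attached to a vector `v` of a tensor product. -/
noncomputable def contract (T : H →L[ℂ] G →L[ℂ] P) (v : P) : H →L⋆[ℂ] G :=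
  (ContinuousLinearMap.apply ℂ G v).comp
    ((ContinuousLinearMap.adjoint (𝕜 := ℂ) (E := G) (F := P)).toContinuousLinearEquiv.toContinuousLinearMap.comp T)

theorem inner_contract (T : H →L[ℂ] G →L[ℂ] P) (v : P) (a : H) (b : G) :
    ⟪contract T v a, b⟫_ℂ = ⟪v, T a b⟫_ℂ := by
  simp [contract, ContinuousLinearMap.adjoint_inner_left]

theorem contract_add (T : H →L[ℂ] G →L[ℂ] P) (v w : P) :
    contract T (v + w) = contract T v + contract T w := by
  ext a; simp [contract]

theorem contract_smul (T : H →L[ℂ] G →L[ℂ] P) (c : ℂ) (v : P) :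
    contract T (c • v) = c • contract T v := by
  ext a; simp [contract]

theorem norm_contract_le (T : H →L[ℂ] G →L[ℂ] P) (v : P) : ‖contract T v‖ ≤ ‖T‖ * ‖v‖ := by
  refine ContinuousLinearMap.opNorm_le_bound _ (by positivity) fun a => ?_
  have h1 : ‖contract T v a‖ ≤ ‖ContinuousLinearMap.adjoint (T a)‖ * ‖v‖ :=
    (ContinuousLinearMap.adjoint (T a)).le_opNorm v
  rw [LinearIsometryEquiv.norm_map] at h1
  calc _ ≤ ‖T a‖ * ‖v‖ := h1
    _ ≤ (‖T‖ * ‖a‖) * ‖v‖ := by gcongr; exact T.le_opNorm a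
    _ = _ := by ring

theorem continuous_contract (T : H →L[ℂ] G →L[ℂ] P) : Continuous (contract T) :=
  (LinearMap.mkContinuous
    { toFun := contract T, map_add' := contract_add T, map_smul' := contract_smul T :
      P →ₗ[ℂ] (H →L⋆[ℂ] G) } ‖T‖ (norm_contract_le T)).continuous

theorem contract_tensor (T : H →L[ℂ] G →L[ℂ] P)
    (hT : ∀ a b a' b', ⟪T a b, T a' b'⟫_ℂ = ⟪a, a'⟫_ℂ * ⟪b, b'⟫_ℂ) (x : H) (y : G) (a : H) :
    contract T (T x y) a = ⟪a, x⟫_ℂ • y := by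
  refine ext_inner_right ℂ fun b => ?_
  rw [inner_contract, hT, inner_smul_left, inner_conj_symm]

theorem isCompact_contract (T : H →L[ℂ] G →L[ℂ] P)
    (hT : ∀ a b a' b', ⟪T a b, T a' b'⟫_ℂ = ⟪a, a'⟫_ℂ * ⟪b, b'⟫_ℂ)
    (hd : ∀ v, (∀ a b, ⟪T a b, v⟫_ℂ = 0) → v = 0) (v : P) :
    IsCompactOperator (contract T v) := by
  let S : Submodule ℂ P :=
    { carrier := {v | IsCompactOperator (contract T v)}
      add_mem' := fun {a b} ha hb => by
        simp only [Set.mem_ofPred_eq, contract_add] at *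
        exact ha.add hb
      zero_mem' := by
        have : contract T (0 : P) = 0 := by ext; simp [contract]
        simp only [Set.mem_ofPred_eq, this]
        exact isCompactOperator_zero
      smul_mem' := fun c a ha => by
        simp only [Set.mem_ofPred_eq, contract_smul] at *
        exact ha.smul c }
  have hS : IsClosed (S : Set P) :=
    isClosed_setOfPred_isCompactOperator.preimage (continuous_contract T)
  have hmem : ∀ x y, T x y ∈ S := by
    intro x y
    have h1 : IsCompactOperator ((innerSL ℂ (E := H)).flip x) :=
      isCompactOperator_of_locallyCompactSpace_dom _
    have h2 : (contract T (T x y) : H → G) = (fun c : ℂ => c • y) ∘ ((innerSL ℂ (E := H)).flip x) := by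
      ext1 a
      rw [contract_tensor T hT]
      simp
    change IsCompactOperator (contract T (T x y))
    rw [h2]
    exact h1.continuous_comp (by fun_prop)
  have : S.topologicalClosure = ⊤ := by
    rw [Submodule.topologicalClosure_eq_top_iff, Submodule.eq_bot_iff]
    intro w hw
    exact hd w fun a b => (Submodule.mem_orthogonal _ _).1 hw _ (hmem a b)
  rw [hS.submodule_topologicalClosure_eq] at this
  exact (this ▸ Submodule.mem_top : v ∈ S)

theorem exists_top (T : H →L[ℂ] G →L[ℂ] P)
    (hT : ∀ a b a' b', ⟪T a b, T a' b'⟫_ℂ = ⟪a, a'⟫_ℂ * ⟪b, b'⟫_ℂ)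
    (hd : ∀ v, (∀ a b, ⟪T a b, v⟫_ℂ = 0) → v = 0) (v : P) (hv : v ≠ 0) :
    ∃ (σ : ℝ) (e : H) (f : G), 0 < σ ∧ ‖e‖ = 1 ∧ ‖f‖ = 1 ∧ contract T v e = (σ : ℂ) • f ∧
      contract T.flip v f = (σ : ℂ) • e ∧ ∀ a, ‖contract T v a‖ ≤ σ * ‖a‖ := by
  obtain ⟨a₀, b₀, h₀⟩ : ∃ a b, ⟪T a b, v⟫_ℂ ≠ 0 := by
    by_contra! h
    exact hv (hd v h)
  have ha₀ : contract T v a₀ ≠ 0 := by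
    intro h
    apply h₀
    rw [← inner_conj_symm, ← inner_contract, h]
    simp
  let A : H →L[ℂ] H := (contract T.flip v).comp (contract T v)
  have hA : ∀ a a', ⟪A a, a'⟫_ℂ = ⟪contract T v a', contract T v a⟫_ℂ := by
    intro a a'
    rw [inner_contract]
    simp only [A, ContinuousLinearMap.comp_apply, inner_contract, ContinuousLinearMap.flip_apply]
  have hsa : IsSelfAdjoint A := by
    rw [ContinuousLinearMap.isSelfAdjoint_iff_isSymmetric]
    intro a a'
    change ⟪A a, a'⟫_ℂ = ⟪a, A a'⟫_ℂ
    rw [hA, ← inner_conj_symm a, hA, inner_conj_symm]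
  have hc : IsCompactOperator A := (isCompact_contract T hT hd v).clm_comp (contract T.flip v)
  have hnorm : ∀ a, ⟪A a, a⟫_ℂ = (‖contract T v a‖ : ℂ) ^ 2 := by
    intro a
    rw [hA, inner_self_eq_norm_sq_to_K]
    rfl
  have hbd : ∀ a, ‖contract T v a‖ ^ 2 ≤ ‖A‖ * ‖a‖ ^ 2 := by
    intro a
    have h1 : ‖⟪A a, a⟫_ℂ‖ ≤ ‖A a‖ * ‖a‖ := norm_inner_le_norm _ _
    rw [hnorm] at h1
    simp only [norm_pow, Complex.norm_real, norm_norm] at h1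
    nlinarith [A.le_opNorm a, norm_nonneg a]
  have hApos : 0 < ‖A‖ := by
    by_contra! h
    have := hbd a₀
    have h3 := norm_pos_iff.2 ha₀
    nlinarith [sq_nonneg ‖a₀‖, pow_pos h3 2]
  have : Nontrivial H := ⟨a₀, 0, fun h => ha₀ (by simp [h])⟩
  obtain ⟨z, hz, hz2⟩ := spectrum.exists_nnnorm_eq_spectralRadius A
  rw [hsa.spectralRadius_eq_nnnorm] at hz2
  have hz3 : ‖z‖ = ‖A‖ := by
    have : ‖z‖₊ = ‖A‖₊ := by exact_mod_cast hz2
    exact congrArg NNReal.toReal this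
  have hz0 : z ≠ 0 := by
    rw [← norm_pos_iff, hz3]; exact hApos
  obtain ⟨e₀, he₀⟩ := ((hc.hasEigenvalue_iff_mem_spectrum hz0).2 hz).exists_hasEigenvector
  have he1 : A e₀ = z • e₀ := he₀.apply_eq_smul
  have hne : ‖e₀‖ ≠ 0 := norm_ne_zero_iff.2 he₀.2
  let e : H := ((‖e₀‖⁻¹ : ℝ) : ℂ) • e₀
  have hen : ‖e‖ = 1 := by simp [e, norm_smul, hne]
  have hAe : A e = z • e := by simp only [e, map_smul, he1, smul_comm z]
  have hzr : z = (‖A‖ : ℂ) := by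
    have h1 := hnorm e
    rw [hAe, inner_smul_left, inner_self_eq_norm_sq_to_K, hen] at h1
    simp only [Complex.coe_algebraMap, Complex.ofReal_one, one_pow, mul_one] at h1
    have h2 : z = ((‖contract T v e‖ ^ 2 : ℝ) : ℂ) := by
      rw [← Complex.conj_conj z, h1]; simp
    have h3 : ‖A‖ = ‖contract T v e‖ ^ 2 := by
      rw [← hz3, h2, Complex.norm_real, Real.norm_of_nonneg (sq_nonneg _)]
    rw [h2, h3]
  have hKe : ‖contract T v e‖ ^ 2 = ‖A‖ := by
    have h1 := hnorm e
    rw [hAe, inner_smul_left, inner_self_eq_norm_sq_to_K, hen, hzr] at h1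
    simp only [Complex.coe_algebraMap, Complex.ofReal_one, one_pow, mul_one, Complex.conj_ofReal] at h1
    exact_mod_cast h1.symm
  set σ := Real.sqrt ‖A‖ with hσ
  have hσ0 : 0 < σ := Real.sqrt_pos.2 hApos
  have hσ2 : σ ^ 2 = ‖A‖ := Real.sq_sqrt hApos.le
  have hσc : (σ : ℂ) ≠ 0 := by exact_mod_cast hσ0.ne'
  have hKe' : ‖contract T v e‖ = σ := by
    rw [hσ, ← hKe, Real.sqrt_sq (norm_nonneg _)]
  refine ⟨σ, e, ((σ⁻¹ : ℝ) : ℂ) • contract T v e, hσ0, hen, ?_, ?_, ?_, ?_⟩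
  · rw [norm_smul, hKe', Complex.norm_real, Real.norm_of_nonneg (by positivity)]
    field_simp
  · rw [smul_smul]; simp [hσc]
  · rw [map_smulₛₗ]
    change _ • A e = _
    rw [hAe, hzr, smul_smul, ← hσ2]
    congr 1
    rw [Complex.conj_ofReal, Complex.ofReal_inv, Complex.ofReal_pow]
    field_simp
  · intro a
    refine abs_le_of_sq_le_sq' ?_ (by positivity) |>.2
    rw [mul_pow, hσ2]
    exact hbd a

/-- One step of the greedy construction of the singular value decomposition. -/
structure TopPair (T : H →L[ℂ] G →L[ℂ] P) (v : P) where
  σ : ℝ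
  e : H
  f : G
  nonneg : 0 ≤ σ
  norm_e : σ ≠ 0 → ‖e‖ = 1
  norm_f : σ ≠ 0 → ‖f‖ = 1
  map_e : σ ≠ 0 → contract T v e = (σ : ℂ) • f
  map_f : σ ≠ 0 → contract T.flip v f = (σ : ℂ) • e
  bound : ∀ a, ‖contract T v a‖ ≤ σ * ‖a‖

theorem nonempty_topPair (T : H →L[ℂ] G →L[ℂ] P)
    (hT : ∀ a b a' b', ⟪T a b, T a' b'⟫_ℂ = ⟪a, a'⟫_ℂ * ⟪b, b'⟫_ℂ)
    (hd : ∀ v, (∀ a b, ⟪T a b, v⟫_ℂ = 0) → v = 0) (v : P) : Nonempty (TopPair T v) := by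
  by_cases hv : v = 0
  · subst hv
    exact ⟨⟨0, 0, 0, le_rfl, by simp, by simp, by simp, by simp, by simp [contract]⟩⟩
  · obtain ⟨σ, e, f, h0, h1, h2, h3, h4, h5⟩ := exists_top T hT hd v hv
    exact ⟨⟨σ, e, f, h0.le, fun _ => h1, fun _ => h2, fun _ => h3, fun _ => h4, h5⟩⟩

theorem exists_svd_abstract (T : H →L[ℂ] G →L[ℂ] P)
    (hT : ∀ a b a' b', ⟪T a b, T a' b'⟫_ℂ = ⟪a, a'⟫_ℂ * ⟪b, b'⟫_ℂ)
    (hd : ∀ v, (∀ a b, ⟪T a b, v⟫_ℂ = 0) → v = 0) (v : P) :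
    ∃ (σ : ℕ → ℝ) (e : ℕ → H) (f : ℕ → G), Antitone σ ∧ (∀ k, 0 ≤ σ k) ∧
      Orthonormal ℂ (fun k : {k // σ k ≠ 0} => e k) ∧
      Orthonormal ℂ (fun k : {k // σ k ≠ 0} => f k) ∧
      HasSum (fun k => (σ k : ℂ) • T (e k) (f k)) v := by
  let p : ∀ x, TopPair T x := fun x => (nonempty_topPair T hT hd x).some
  let w : ℕ → P := fun k => Nat.rec v (fun _ x => x - ((p x).σ : ℂ) • T (p x).e (p x).f) k
  let σ : ℕ → ℝ := fun k => (p (w k)).σ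
  let e : ℕ → H := fun k => (p (w k)).e
  let f : ℕ → G := fun k => (p (w k)).f
  have hw0 : w 0 = v := rfl
  have hw : ∀ k, w (k + 1) = w k - (σ k : ℂ) • T (e k) (f k) := fun k => rfl
  have hσ0 : ∀ k, 0 ≤ σ k := fun k => (p (w k)).nonneg
  have hTf : ∀ a b a' b', ⟪T.flip a b, T.flip a' b'⟫_ℂ = ⟪a, a'⟫_ℂ * ⟪b, b'⟫_ℂ := by
    intro a b a' b'
    simp [hT, mul_comm]
  -- action of the contraction after one step
  have hK : ∀ k a, contract T (w (k + 1)) a =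
      contract T (w k) a - ((σ k : ℂ) * ⟪a, e k⟫_ℂ) • f k := by
    intro k a
    have h1 : w k = w (k + 1) + (σ k : ℂ) • T (e k) (f k) := by rw [hw]; abel
    conv_rhs => rw [h1]
    rw [contract_add, contract_smul]
    rw [add_apply, smul_apply, contract_tensor T hT,
      smul_smul, add_sub_cancel_right]
  have hL : ∀ k b, contract T.flip (w (k + 1)) b =
      contract T.flip (w k) b - ((σ k : ℂ) * ⟪b, f k⟫_ℂ) • e k := by
    intro k b
    have h1 : w k = w (k + 1) + (σ k : ℂ) • T.flip (f k) (e k) := by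
      rw [hw, ContinuousLinearMap.flip_apply]; abel
    conv_rhs => rw [h1]
    rw [contract_add, contract_smul]
    rw [add_apply, smul_apply, contract_tensor T.flip hTf,
      smul_smul, add_sub_cancel_right]
  -- the previous left and right vectors are annihilated
  have hKe : ∀ k, σ k ≠ 0 → contract T (w (k + 1)) (e k) = 0 := by
    intro k hk
    have h1 : contract T (w k) (e k) = (σ k : ℂ) • f k := (p (w k)).map_e hk
    have h2 : ‖e k‖ = 1 := (p (w k)).norm_e hk
    rw [hK, h1, inner_self_eq_norm_sq_to_K, h2]
    simp
  have hLf : ∀ k, σ k ≠ 0 → contract T.flip (w (k + 1)) (f k) = 0 := by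
    intro k hk
    have h1 : contract T.flip (w k) (f k) = (σ k : ℂ) • e k := (p (w k)).map_f hk
    have h2 : ‖f k‖ = 1 := (p (w k)).norm_f hk
    rw [hL, h1, inner_self_eq_norm_sq_to_K, h2]
    simp
  have horthK : ∀ k a, contract T (w k) a = 0 → σ k ≠ 0 → ⟪a, e k⟫_ℂ = 0 := by
    intro k a ha hk
    have h1 : contract T.flip (w k) (f k) = (σ k : ℂ) • e k := (p (w k)).map_f hk
    have h2 : ⟪(σ k : ℂ) • e k, a⟫_ℂ = 0 := by
      rw [← h1, inner_contract, ContinuousLinearMap.flip_apply, ← inner_contract, ha, inner_zero_left]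
    rw [inner_smul_left, mul_eq_zero] at h2
    rcases h2 with h2 | h2
    · simp [hk] at h2
    · rw [← inner_conj_symm, h2, map_zero]
  have horthL : ∀ k b, contract T.flip (w k) b = 0 → σ k ≠ 0 → ⟪b, f k⟫_ℂ = 0 := by
    intro k b hb hk
    have h1 : contract T (w k) (e k) = (σ k : ℂ) • f k := (p (w k)).map_e hk
    have h2 : ⟪(σ k : ℂ) • f k, b⟫_ℂ = 0 := by
      rw [← h1, inner_contract, ← ContinuousLinearMap.flip_apply, ← inner_contract, hb,
        inner_zero_left]
    rw [inner_smul_left, mul_eq_zero] at h2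
    rcases h2 with h2 | h2
    · simp [hk] at h2
    · rw [← inner_conj_symm, h2, map_zero]
  have hpersK : ∀ k a, contract T (w k) a = 0 → contract T (w (k + 1)) a = 0 := by
    intro k a ha
    rw [hK, ha]
    by_cases hk : σ k = 0
    · simp [hk]
    · simp [horthK k a ha hk]
  have hpersL : ∀ k b, contract T.flip (w k) b = 0 → contract T.flip (w (k + 1)) b = 0 := by
    intro k b hb
    rw [hL, hb]
    by_cases hk : σ k = 0
    · simp [hk]
    · simp [horthL k b hb hk]
  have hannK : ∀ j k, j < k → σ j ≠ 0 → contract T (w k) (e j) = 0 := by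
    intro j k hjk hj
    induction k, hjk using Nat.le_induction with
    | base => exact hKe j hj
    | succ k _ ih => exact hpersK k _ ih
  have hannL : ∀ j k, j < k → σ j ≠ 0 → contract T.flip (w k) (f j) = 0 := by
    intro j k hjk hj
    induction k, hjk using Nat.le_induction with
    | base => exact hLf j hj
    | succ k _ ih => exact hpersL k _ ih
  have horE : ∀ j k, j < k → σ j ≠ 0 → σ k ≠ 0 → ⟪e j, e k⟫_ℂ = 0 := fun j k h hj hk =>
    horthK k _ (hannK j k h hj) hk
  have horF : ∀ j k, j < k → σ j ≠ 0 → σ k ≠ 0 → ⟪f j, f k⟫_ℂ = 0 := fun j k h hj hk =>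
    horthL k _ (hannL j k h hj) hk
  have honE : Orthonormal ℂ (fun k : {k // σ k ≠ 0} => e k) := by
    refine ⟨fun k => (p (w k)).norm_e k.2, fun j k hjk => ?_⟩
    rcases lt_or_gt_of_ne (fun h => hjk (Subtype.ext h) : (j : ℕ) ≠ k) with h | h
    · exact horE _ _ h j.2 k.2
    · rw [← inner_conj_symm, horE _ _ h k.2 j.2, map_zero]
  have honF : Orthonormal ℂ (fun k : {k // σ k ≠ 0} => f k) := by
    refine ⟨fun k => (p (w k)).norm_f k.2, fun j k hjk => ?_⟩
    rcases lt_or_gt_of_ne (fun h => hjk (Subtype.ext h) : (j : ℕ) ≠ k) with h | h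
    · exact horF _ _ h j.2 k.2
    · rw [← inner_conj_symm, horF _ _ h k.2 j.2, map_zero]
  have hanti : Antitone σ := by
    refine antitone_nat_of_succ_le fun k => ?_
    by_cases hk1 : σ (k + 1) = 0
    · rw [hk1]; exact hσ0 k
    by_cases hk : σ k = 0
    · exfalso
      apply hk1
      have : w (k + 1) = w k := by rw [hw, hk]; simp
      have h2 : σ (k + 1) = σ k := congrArg (fun x => (p x).σ) this
      rw [h2, hk]
    have h1 : contract T (w (k + 1)) (e (k + 1)) = (σ (k + 1) : ℂ) • f (k + 1) :=
      (p (w (k + 1))).map_e hk1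
    have h2 : ‖f (k + 1)‖ = 1 := (p (w (k + 1))).norm_f hk1
    have h3 : ‖e (k + 1)‖ = 1 := (p (w (k + 1))).norm_e hk1
    have h4 : ⟪e (k + 1), e k⟫_ℂ = 0 := by
      rw [← inner_conj_symm, horE k (k + 1) (Nat.lt_succ_self k) hk hk1, map_zero]
    rw [hK, h4, mul_zero, zero_smul, sub_zero] at h1
    have h5 : ‖contract T (w k) (e (k + 1))‖ ≤ σ k * ‖e (k + 1)‖ := (p (w k)).bound _
    rw [h1, norm_smul, h2, h3, Complex.norm_real,
      Real.norm_of_nonneg (hσ0 (k + 1))] at h5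
    simpa using h5
  refine ⟨σ, e, f, hanti, hσ0, honE, honF, ?_⟩
  -- convergence
  let x : ℕ → P := fun k => (σ k : ℂ) • T (e k) (f k)
  have hx0 : ∀ k, σ k = 0 → x k = 0 := fun k hk => by simp [x, hk]
  have hxo : ∀ j k, j ≠ k → ⟪x j, x k⟫_ℂ = 0 := by
    intro j k hjk
    by_cases hj : σ j = 0
    · rw [hx0 j hj, inner_zero_left]
    by_cases hk : σ k = 0
    · rw [hx0 k hk, inner_zero_right]
    have : ⟪e j, e k⟫_ℂ = 0 := honE.2 (i := ⟨j, hj⟩) (j := ⟨k, hk⟩) (fun h => hjk (congrArg Subtype.val h))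
    simp [x, inner_smul_left, inner_smul_right, hT, this]
  have hpyth : ∀ k, ‖w k‖ ^ 2 = ‖w (k + 1)‖ ^ 2 + ‖x k‖ ^ 2 := by
    intro k
    have h1 : w k = w (k + 1) + x k := by rw [hw]; simp [x]
    have h2 : ⟪w (k + 1), x k⟫_ℂ = 0 := by
      by_cases hk : σ k = 0
      · rw [hx0 k hk, inner_zero_right]
      · rw [inner_smul_right, ← inner_contract, hKe k hk, inner_zero_left, mul_zero]
    rw [h1, @norm_add_sq ℂ, h2]
    simp
  have hsumsq : ∀ n, ∑ k ∈ Finset.range n, ‖x k‖ ^ 2 = ‖v‖ ^ 2 - ‖w n‖ ^ 2 := by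
    intro n
    induction n with
    | zero => simp [hw0]
    | succ n ih => rw [Finset.sum_range_succ, ih, hpyth n]; ring
  have hsq : Summable (fun k => ‖x k‖ ^ 2) :=
    summable_of_sum_range_le (c := ‖v‖ ^ 2) (fun k => by positivity) fun n => by
      rw [hsumsq]; nlinarith [sq_nonneg ‖w n‖]
  have hfam : OrthogonalFamily ℂ (fun k => (ℂ ∙ x k : Submodule ℂ P))
      (fun k => (ℂ ∙ x k : Submodule ℂ P).subtypeₗᵢ) := by
    refine OrthogonalFamily.of_pairwise fun j k hjk => ?_
    change (ℂ ∙ x j) ⟂ (ℂ ∙ x k)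
    rw [Submodule.isOrtho_span]
    intro a ha b hb
    rw [Set.mem_singleton_iff.1 ha, Set.mem_singleton_iff.1 hb]
    exact hxo j k hjk
  have hsum : Summable x :=
    (hfam.summable_iff_norm_sq_summable
      (fun k => ⟨x k, Submodule.mem_span_singleton_self _⟩)).2 hsq
  have hpart : ∀ n, ∑ k ∈ Finset.range n, x k = v - w n := by
    intro n
    induction n with
    | zero => simp [hw0]
    | succ n ih => rw [Finset.sum_range_succ, ih, hw]; simp only [x]; abel
  have htend := hsum.hasSum.tendsto_sum_nat
  have hwl : Filter.Tendsto w Filter.atTop (nhds (v - ∑' k, x k)) := by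
    have h1 := (tendsto_const_nhds (x := v)).sub htend
    refine h1.congr fun n => ?_
    rw [hpart]; abel
  have hσx : ∀ k, σ k ^ 2 = ‖x k‖ ^ 2 := by
    intro k
    by_cases hk : σ k = 0
    · rw [hx0 k hk, hk]; simp
    have h1 : ‖e k‖ = 1 := (p (w k)).norm_e hk
    have h2 : ‖f k‖ = 1 := (p (w k)).norm_f hk
    have h3 : ⟪x k, x k⟫_ℂ = (σ k : ℂ) ^ 2 := by
      change ⟪(σ k : ℂ) • T (e k) (f k), (σ k : ℂ) • T (e k) (f k)⟫_ℂ = _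
      rw [inner_smul_left, inner_smul_right, hT, inner_self_eq_norm_sq_to_K,
        inner_self_eq_norm_sq_to_K, h1, h2, Complex.conj_ofReal]
      simp [sq]
    rw [inner_self_eq_norm_sq_to_K] at h3
    have h4 : ((‖x k‖ ^ 2 : ℝ) : ℂ) = ((σ k ^ 2 : ℝ) : ℂ) := by push_cast; exact h3
    exact (Complex.ofReal_injective h4).symm
  have hσt : Filter.Tendsto (fun k => σ k ^ 2) Filter.atTop (nhds 0) := by
    simp only [hσx]
    exact hsq.tendsto_atTop_zero
  have hσt' : Filter.Tendsto σ Filter.atTop (nhds 0) := by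
    have h1 := (Real.continuous_sqrt.tendsto 0).comp hσt
    rw [Real.sqrt_zero] at h1
    exact h1.congr fun k => Real.sqrt_sq (hσ0 k)
  have hlim : v - ∑' k, x k = 0 := by
    have h0 : ∀ a, contract T (v - ∑' k, x k) a = 0 := by
      intro a
      have hcont : Continuous (fun y => ‖contract T y a‖) :=
        (ContinuousLinearMap.adjoint (T a)).continuous.norm
      have h1 : Filter.Tendsto (fun k => ‖contract T (w k) a‖) Filter.atTop
          (nhds ‖contract T (v - ∑' k, x k) a‖) :=
        (hcont.tendsto _).comp hwl
      have h2 : Filter.Tendsto (fun k => σ k * ‖a‖) Filter.atTop (nhds 0) := by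
        simpa using hσt'.mul_const ‖a‖
      have h3 := le_of_tendsto_of_tendsto' h1 h2 fun k => (p (w k)).bound a
      exact norm_le_zero_iff.1 h3
    refine hd _ fun a b => ?_
    rw [← inner_conj_symm, ← inner_contract, h0, inner_zero_left, map_zero]
  have := hsum.hasSum
  rwa [← sub_eq_zero.1 hlim] at this

end Abstract
/-! ### Elementary tensors and tensor products of operators -/

section Tensor
variable {X Y : Type*} [MeasurableSpace X] [MeasurableSpace Y]
  {μ : Measure X} {ν : Measure Y} [SigmaFinite μ] [SigmaFinite ν]

theorem memLp_tensor (f : Lp ℂ 2 μ) (g : Lp ℂ 2 ν) :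
    MemLp (fun z : X × Y => f z.1 * g z.2) 2 (μ.prod ν) := by
  have hf := Lp.memLp f
  have hg := Lp.memLp g
  have hm : AEStronglyMeasurable (fun z : X × Y => f z.1 * g z.2) (μ.prod ν) :=
    hf.1.comp_fst.mul hg.1.comp_snd
  rw [memLp_two_iff_integrable_sq_norm hm]
  have h1 := (memLp_two_iff_integrable_sq_norm hf.1).1 hf
  have h2 := (memLp_two_iff_integrable_sq_norm hg.1).1 hg
  simpa [mul_pow] using h1.mul_prod h2

/-- The elementary tensor `f ⊗ g`, that is the function `(x, y) ↦ f x * g y`. -/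
noncomputable def tensor (f : Lp ℂ 2 μ) (g : Lp ℂ 2 ν) : Lp ℂ 2 (μ.prod ν) :=
  (memLp_tensor f g).toLp

theorem coeFn_tensor (f : Lp ℂ 2 μ) (g : Lp ℂ 2 ν) :
    tensor f g =ᵐ[μ.prod ν] fun z => f z.1 * g z.2 :=
  MemLp.coeFn_toLp _

theorem inner_tensor (f f' : Lp ℂ 2 μ) (g g' : Lp ℂ 2 ν) :
    ⟪tensor f g, tensor f' g'⟫_ℂ = ⟪f, f'⟫_ℂ * ⟪g, g'⟫_ℂ := by
  simp only [L2.inner_def]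
  rw [← integral_prod_mul]
  refine integral_congr_ae ?_
  filter_upwards [coeFn_tensor f g, coeFn_tensor f' g'] with z h1 h2
  simp only [h1, h2, RCLike.inner_apply, map_mul]
  ring

theorem ae_fst {p : X → Prop} (h : ∀ᵐ x ∂μ, p x) : ∀ᵐ z ∂μ.prod ν, p z.1 :=
  Measure.quasiMeasurePreserving_fst.ae h

theorem ae_snd {p : Y → Prop} (h : ∀ᵐ x ∂ν, p x) : ∀ᵐ z ∂μ.prod ν, p z.2 :=
  Measure.quasiMeasurePreserving_snd.ae h

variable (μ ν) in
/-- The map `(f, g) ↦ f ⊗ g` as a bilinear map. -/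
noncomputable def tensorₗ : Lp ℂ 2 μ →ₗ[ℂ] Lp ℂ 2 ν →ₗ[ℂ] Lp ℂ 2 (μ.prod ν) :=
  LinearMap.mk₂ ℂ tensor
    (fun f f' g => by
      apply Lp.ext
      filter_upwards [coeFn_tensor (f + f') g, coeFn_tensor f g, coeFn_tensor f' g,
        Lp.coeFn_add (tensor f g) (tensor f' g), ae_fst (ν := ν) (Lp.coeFn_add f f')]
        with z h1 h2 h3 h4 h5
      rw [h1, h4, Pi.add_apply, h2, h3, h5, Pi.add_apply, add_mul])
    (fun c f g => by
      apply Lp.ext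
      filter_upwards [coeFn_tensor (c • f) g, coeFn_tensor f g,
        Lp.coeFn_smul c (tensor f g), ae_fst (ν := ν) (Lp.coeFn_smul c f)]
        with z h1 h2 h3 h4
      simp [h1, h2, h3, h4, mul_assoc])
    (fun f g g' => by
      apply Lp.ext
      filter_upwards [coeFn_tensor f (g + g'), coeFn_tensor f g, coeFn_tensor f g',
        Lp.coeFn_add (tensor f g) (tensor f g'), ae_snd (μ := μ) (Lp.coeFn_add g g')]
        with z h1 h2 h3 h4 h5
      rw [h1, h4, Pi.add_apply, h2, h3, h5, Pi.add_apply, mul_add])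
    (fun c f g => by
      apply Lp.ext
      filter_upwards [coeFn_tensor f (c • g), coeFn_tensor f g,
        Lp.coeFn_smul c (tensor f g), ae_snd (μ := μ) (Lp.coeFn_smul c g)]
        with z h1 h2 h3 h4
      simp [h1, h2, h3, h4, mul_left_comm])

@[simp] theorem tensorₗ_apply (f : Lp ℂ 2 μ) (g : Lp ℂ 2 ν) : tensorₗ μ ν f g = tensor f g := rfl

variable (μ ν) in
/-- The canonical isometric embedding of the algebraic tensor product. -/
noncomputable def tensorLift : (Lp ℂ 2 μ ⊗[ℂ] Lp ℂ 2 ν) →ₗ[ℂ] Lp ℂ 2 (μ.prod ν) :=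
  TensorProduct.lift (tensorₗ μ ν)

theorem inner_tensorLift (x y : Lp ℂ 2 μ ⊗[ℂ] Lp ℂ 2 ν) :
    ⟪tensorLift μ ν x, tensorLift μ ν y⟫_ℂ = ⟪x, y⟫_ℂ := by
  induction x with
  | zero => simp
  | add x x' hx hx' => simp [inner_add_left, hx, hx']
  | tmul f g =>
    induction y with
    | zero => simp
    | add y y' hy hy' => simp [inner_add_right, hy, hy']
    | tmul f' g' => simp [tensorLift, inner_tensor]

theorem norm_tensorLift (x : Lp ℂ 2 μ ⊗[ℂ] Lp ℂ 2 ν) : ‖tensorLift μ ν x‖ = ‖x‖ := by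
  rw [norm_eq_sqrt_re_inner (𝕜 := ℂ), norm_eq_sqrt_re_inner (𝕜 := ℂ), inner_tensorLift]

theorem eq_zero_of_inner_tensor (v : Lp ℂ 2 (μ.prod ν))
    (hv : ∀ f g, ⟪(tensor f g : Lp ℂ 2 (μ.prod ν)), v⟫_ℂ = 0) : v = 0 := by
  -- integrals over rectangles of finite measure vanish
  have hrect : ∀ A B, MeasurableSet A → MeasurableSet B → μ A ≠ ⊤ → ν B ≠ ⊤ →
      ∫ z in A ×ˢ B, v z ∂μ.prod ν = 0 := by
    intro A B hA hB hμ hν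
    have h := hv (indicatorConstLp 2 hA hμ 1) (indicatorConstLp 2 hB hν 1)
    rw [L2.inner_def] at h
    rw [← h, ← integral_indicator (hA.prod hB)]
    refine integral_congr_ae ?_
    filter_upwards [coeFn_tensor (indicatorConstLp 2 hA hμ (1 : ℂ)) (indicatorConstLp 2 hB hν (1 : ℂ)),
      ae_fst (ν := ν) (indicatorConstLp_coeFn (p := 2) (hs := hA) (hμs := hμ) (c := (1 : ℂ))),
      ae_snd (μ := μ) (indicatorConstLp_coeFn (p := 2) (hs := hB) (hμs := hν) (c := (1 : ℂ)))]
      with z h1 h2 h3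
    rw [h1, h2, h3]
    by_cases ha : z.1 ∈ A <;> by_cases hb : z.2 ∈ B <;> simp [Set.indicator, ha, hb]
  let R : ℕ → Set (X × Y) := fun n => spanningSets μ n ×ˢ spanningSets ν n
  have hRm : ∀ n, MeasurableSet (R n) := fun n =>
    (measurableSet_spanningSets μ n).prod (measurableSet_spanningSets ν n)
  have hRf : ∀ n, μ.prod ν (R n) ≠ ⊤ := fun n => by
    rw [Measure.prod_prod]
    exact ENNReal.mul_ne_top (measure_spanningSets_lt_top μ n).ne
      (measure_spanningSets_lt_top ν n).ne
  have hRi : ∀ n, IntegrableOn v (R n) (μ.prod ν) := fun n =>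
    integrableOn_Lp_of_measure_ne_top v fact_one_le_two_ennreal.elim (hRf n)
  have key : ∀ n, ∀ s, MeasurableSet s → ∫ z in s ∩ R n, v z ∂μ.prod ν = 0 := by
    intro n s hs
    induction s, hs using MeasurableSpace.induction_on_inter
      (generateFrom_prod (α := X) (β := Y)).symm isPiSystem_prod with
    | empty => simp
    | basic t ht =>
      obtain ⟨A, hA, B, hB, rfl⟩ := ht
      rw [Set.prod_inter_prod]
      refine hrect _ _ (hA.inter (measurableSet_spanningSets μ n))
        (hB.inter (measurableSet_spanningSets ν n)) ?_ ?_
      · exact measure_ne_top_of_subset Set.inter_subset_right (measure_spanningSets_lt_top μ n).ne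
      · exact measure_ne_top_of_subset Set.inter_subset_right (measure_spanningSets_lt_top ν n).ne
    | compl t ht ih =>
      have h0 : ∫ z in R n, v z ∂μ.prod ν = 0 := hrect _ _ (measurableSet_spanningSets μ n)
        (measurableSet_spanningSets ν n) (measure_spanningSets_lt_top μ n).ne
        (measure_spanningSets_lt_top ν n).ne
      have h1 := integral_inter_add_sdiff (s := R n) ht (hRi n)
      rw [Set.inter_comm, ih, zero_add, h0] at h1
      rw [← h1]
      congr 2
      ext z
      simp [and_comm]
    | iUnion f hd hm ih =>
      rw [Set.iUnion_inter]
      rw [integral_iUnion (fun i => (hm i).inter (hRm n))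
        (fun i j hij => (hd hij).mono Set.inter_subset_left Set.inter_subset_left)
        ((hRi n).mono_set (by simp))]
      simp [ih]
  have hae : ∀ n, ∀ᵐ z ∂(μ.prod ν).restrict (R n), v z = 0 := by
    intro n
    refine Integrable.ae_eq_zero_of_forall_setIntegral_eq_zero (hRi n) ?_
    intro s hs _
    rw [Measure.restrict_restrict hs]
    exact key n s hs
  have hU : ⋃ n, R n = Set.univ := by
    rw [Set.eq_univ_iff_forall]
    intro z
    obtain ⟨m, hm⟩ := Set.mem_iUnion.1
      ((iUnion_spanningSets μ).symm ▸ Set.mem_univ z.1 : z.1 ∈ ⋃ i, spanningSets μ i)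
    obtain ⟨k, hk⟩ := Set.mem_iUnion.1
      ((iUnion_spanningSets ν).symm ▸ Set.mem_univ z.2 : z.2 ∈ ⋃ i, spanningSets ν i)
    exact Set.mem_iUnion.2 ⟨max m k, monotone_spanningSets μ (le_max_left _ _) hm,
      monotone_spanningSets ν (le_max_right _ _) hk⟩
  have hall : ∀ᵐ z ∂μ.prod ν, v z = 0 := by
    have := (ae_restrict_iUnion_iff R (fun z => v z = 0) (μ := μ.prod ν)).2 hae
    rwa [hU, Measure.restrict_univ] at this
  exact (Lp.eq_zero_iff_ae_eq_zero).2 hall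

theorem denseRange_tensorLift : DenseRange (tensorLift μ ν) := by
  have h : (LinearMap.range (tensorLift μ ν)).topologicalClosure = ⊤ := by
    rw [Submodule.topologicalClosure_eq_top_iff, Submodule.eq_bot_iff]
    intro v hv
    refine eq_zero_of_inner_tensor v fun f g => ?_
    exact (Submodule.mem_orthogonal _ _).1 hv _ ⟨f ⊗ₜ g, by simp [tensorLift]⟩
  have h2 := (Submodule.dense_iff_topologicalClosure_eq_top).2 h
  rwa [LinearMap.coe_range] at h2

/-- The tensor product `S ⊗ T` of two unitary operators, acting on `L²` of the product. It is the
unique continuous linear map with `f ⊗ g ↦ S f ⊗ T g`. -/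
noncomputable def tensorUnitary (S : Lp ℂ 2 μ ≃ₗᵢ[ℂ] Lp ℂ 2 μ) (T : Lp ℂ 2 ν ≃ₗᵢ[ℂ] Lp ℂ 2 ν) :
    Lp ℂ 2 (μ.prod ν) ≃ₗᵢ[ℂ] Lp ℂ 2 (μ.prod ν) :=
  (TensorProduct.congrIsometry S T).toLinearEquiv.extendOfIsometry
    (tensorLift μ ν) (tensorLift μ ν) denseRange_tensorLift denseRange_tensorLift
    (fun x => by
      rw [norm_tensorLift, norm_tensorLift]
      exact (TensorProduct.congrIsometry S T).norm_map x)

theorem tensorUnitary_tensor (S : Lp ℂ 2 μ ≃ₗᵢ[ℂ] Lp ℂ 2 μ) (T : Lp ℂ 2 ν ≃ₗᵢ[ℂ] Lp ℂ 2 ν)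
    (f : Lp ℂ 2 μ) (g : Lp ℂ 2 ν) :
    tensorUnitary S T (tensor f g) = tensor (S f) (T g) := by
  have h := LinearEquiv.extendOfIsometry_eq (TensorProduct.congrIsometry S T).toLinearEquiv
    (tensorLift μ ν) (tensorLift μ ν) denseRange_tensorLift denseRange_tensorLift
    (fun x => by
      rw [norm_tensorLift, norm_tensorLift]
      exact (TensorProduct.congrIsometry S T).norm_map x) (f ⊗ₜ g)
  simpa only [tensorLift, TensorProduct.lift.tmul] using! h

/-! ### Rank and singular value decomposition in `L²` of a product -/

/-- The rank of `v ∈ L²(X × Y)`: the least number of elementary tensors with sum `v`, and `⊤` if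
there is no finite such number. -/
noncomputable def rank (v : Lp ℂ 2 (μ.prod ν)) : ℕ∞ :=
  ⨅ (r : ℕ) (_ : ∃ (f : Fin r → Lp ℂ 2 μ) (g : Fin r → Lp ℂ 2 ν), v = ∑ i, tensor (f i) (g i)),
    (r : ℕ∞)

/-- A singular value decomposition `v = ∑ k, σ k • e k ⊗ f k` with non-increasing `σ`. The singular
vectors that belong to nonzero singular values are orthonormal (the remaining ones do not
contribute; this also covers the case that one of the two `L²` spaces has finite dimension). -/
structure SVD (v : Lp ℂ 2 (μ.prod ν)) where
  σ : ℕ → ℝ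
  e : ℕ → Lp ℂ 2 μ
  f : ℕ → Lp ℂ 2 ν
  antitone : Antitone σ
  nonneg : ∀ k, 0 ≤ σ k
  orthonormal_left : Orthonormal ℂ (fun k : {k // σ k ≠ 0} => e k)
  orthonormal_right : Orthonormal ℂ (fun k : {k // σ k ≠ 0} => f k)
  hasSum : HasSum (fun k => (σ k : ℂ) • tensor (e k) (f k)) v

theorem norm_tensor (f : Lp ℂ 2 μ) (g : Lp ℂ 2 ν) :
    ‖(tensor f g : Lp ℂ 2 (μ.prod ν))‖ = ‖f‖ * ‖g‖ := by
  have h : tensorLift μ ν (f ⊗ₜ g) = tensor f g := by simp [tensorLift]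
  rw [← h, norm_tensorLift, TensorProduct.norm_tmul]

theorem nonempty_svd (v : Lp ℂ 2 (μ.prod ν)) : Nonempty (SVD v) := by
  let T : Lp ℂ 2 μ →L[ℂ] Lp ℂ 2 ν →L[ℂ] Lp ℂ 2 (μ.prod ν) :=
    LinearMap.mkContinuous₂ (tensorₗ μ ν) 1 fun f g => by
      rw [tensorₗ_apply, norm_tensor, one_mul]
  obtain ⟨σ, e, f, h1, h2, h3, h4, h5⟩ := exists_svd_abstract T
    (fun a b a' b' => inner_tensor a a' b b') (fun v hv => eq_zero_of_inner_tensor v hv) v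
  exact ⟨⟨σ, e, f, h1, h2, h3, h4, h5⟩⟩

/-- A fixed choice of a singular value decomposition. -/
noncomputable def svd (v : Lp ℂ 2 (μ.prod ν)) : SVD v := (nonempty_svd v).some

/-- The largest singular value. -/
noncomputable def sigmaMax (v : Lp ℂ 2 (μ.prod ν)) : ℝ := (svd v).σ 0

/-- Soft thresholding `S_α v = ∑ k, max (σ k - α) 0 • e k ⊗ f k`. -/
noncomputable def softThreshold (α : ℝ) (v : Lp ℂ 2 (μ.prod ν)) : Lp ℂ 2 (μ.prod ν) :=
  ∑' k, ((max ((svd v).σ k - α) 0 : ℝ) : ℂ) • tensor ((svd v).e k) ((svd v).f k)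

/-- `w` is a recompression `R_δ v` of `v`: for some singular value decomposition of `v`, it is the
truncation to the least number `r` of terms for which the squares of the omitted singular values
sum up to at most `δ ^ 2`. (The decomposition is left open, since for multiple singular values the
truncation depends on it.) -/
def IsRecompression (δ : ℝ) (v w : Lp ℂ 2 (μ.prod ν)) : Prop :=
  ∃ (s : SVD v) (r : ℕ), IsLeast {r : ℕ | ∑' k, s.σ (r + k) ^ 2 ≤ δ ^ 2} r ∧
    w = ∑ k ∈ Finset.range r, (s.σ k : ℂ) • tensor (s.e k) (s.f k)

end Tensor

/-! ### The Laplacian and the free Schrödinger group -/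

/-- `ℝᵈ` with the Euclidean norm. -/
abbrev Space (d : ℕ) := EuclideanSpace ℝ (Fin d)

/-- `L²(Ω)`, complex-valued. -/
noncomputable abbrev L2 {d : ℕ} (Ω : Set (Space d)) := Lp ℂ 2 (volume.restrict Ω)

/-- Lebesgue measure on `Ω₁ × Ω₂`. -/
noncomputable abbrev prodMeasure {d₁ d₂ : ℕ} (Ω₁ : Set (Space d₁)) (Ω₂ : Set (Space d₂)) :
    Measure (Space d₁ × Space d₂) :=
  (volume.restrict Ω₁).prod (volume.restrict Ω₂)

/-- `L²(Ω₁ × Ω₂)`, complex-valued. -/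
noncomputable abbrev L2Prod {d₁ d₂ : ℕ} (Ω₁ : Set (Space d₁)) (Ω₂ : Set (Space d₂)) :=
  Lp ℂ 2 (prodMeasure Ω₁ Ω₂)

/-- `A` is a self-adjoint realization of the Laplacian on `L²(Ω)` (for any boundary conditions): it
is self-adjoint, and `A φ = Δ φ` for all test functions `φ ∈ C_c^∞(Ω)`. -/
structure IsLaplacian {d : ℕ} {Ω : Set (Space d)} (A : L2 Ω →ₗ.[ℂ] L2 Ω) : Prop where
  isSelfAdjoint : IsSelfAdjoint A
  extends_laplacian : ∀ φ : Space d → ℂ, ContDiff ℝ (⊤ : ℕ∞) φ → HasCompactSupport φ →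
    tsupport φ ⊆ Ω → ∀ f g : L2 Ω, f =ᵐ[volume.restrict Ω] φ →
      g =ᵐ[volume.restrict Ω] Laplacian.laplacian φ → (f, g) ∈ A.graph

/-- `U t = e^{itA}`: `U` is a strongly continuous unitary group with generator `iA`. -/
structure IsUnitaryGroup {E : Type*} [NormedAddCommGroup E] [InnerProductSpace ℂ E]
    (A : E →ₗ.[ℂ] E) (U : ℝ → E ≃ₗᵢ[ℂ] E) : Prop where
  map_zero : ∀ f, U 0 f = f
  map_add : ∀ s t f, U (s + t) f = U s (U t f)
  continuous : ∀ f, Continuous fun t => U t f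
  generator : ∀ f g, (f, g) ∈ A.graph ↔ HasDerivAt (fun t => U t f) (Complex.I • g) 0

/-- The group `e^{itΔ} = e^{itΔ₁} ⊗ e^{itΔ₂}` on `L²(Ω₁ × Ω₂)` for `Δ = Δ₁ ⊗ I + I ⊗ Δ₂`. -/
noncomputable def productGroup {d₁ d₂ : ℕ} {Ω₁ : Set (Space d₁)} {Ω₂ : Set (Space d₂)}
    (U₁ : ℝ → L2 Ω₁ ≃ₗᵢ[ℂ] L2 Ω₁) (U₂ : ℝ → L2 Ω₂ ≃ₗᵢ[ℂ] L2 Ω₂) (t : ℝ) :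
    L2Prod Ω₁ Ω₂ ≃ₗᵢ[ℂ] L2Prod Ω₁ Ω₂ :=
  tensorUnitary (U₁ t) (U₂ t)

/-- Multiplication by an essentially bounded potential `V`, as an operator on `L²(Ω₁ × Ω₂)`. -/
noncomputable def potentialOp {d₁ d₂ : ℕ} {Ω₁ : Set (Space d₁)} {Ω₂ : Set (Space d₂)}
    (V : L2Prod Ω₁ Ω₂) (hV : MemLp V ⊤ (prodMeasure Ω₁ Ω₂)) : L2Prod Ω₁ Ω₂ →L[ℂ] L2Prod Ω₁ Ω₂ :=
  (ContinuousLinearMap.mul ℂ ℂ).holderL (prodMeasure Ω₁ Ω₂) ⊤ 2 2 (hV.toLp V)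

/-! ### The fixed-point iteration -/

/-- The Gauss-Legendre nodes `t₁ < ⋯ < t_J` in `[0, h]`: the roots of the Legendre polynomial of
degree `J`, transported to `[0, h]`. -/
structure IsGaussLegendre {J : ℕ} (h : ℝ) (t : Fin J → ℝ) : Prop where
  strictMono : StrictMono t
  mem_Icc : ∀ j, t j ∈ Set.Icc 0 h
  isRoot : ∀ j, Polynomial.aeval (t j / h) (Polynomial.shiftedLegendre J) = 0

/-- The Lagrange polynomials `ℓ_j` of the nodes `t`. -/
noncomputable def lagrange {J : ℕ} (t : Fin J → ℝ) (j : Fin J) (s : ℝ) : ℝ :=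
  ∏ m ∈ Finset.univ.erase j, (s - t m) / (t j - t m)

/-- `Λ_J`, the average over `[0, h]` of the Lebesgue function of the nodes. -/
noncomputable def avgLebesgue {J : ℕ} (h : ℝ) (t : Fin J → ℝ) : ℝ :=
  1 / h * ∫ s in (0 : ℝ)..h, ∑ m, |lagrange t m s|

section Iteration
variable {𝓗 : Type*} [NormedAddCommGroup 𝓗] [InnerProductSpace ℂ 𝓗]

/-- `u` is the exact solution on `[0, h]` of `i ∂ₜ u = -Δ u + V u`, `u(0) = u₀`, in the sense of
Duhamel's formula; `E t = e^{itΔ}` and `M` is the multiplication by `V`. -/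
structure IsSchrodingerSolution (E : ℝ → 𝓗 ≃ₗᵢ[ℂ] 𝓗) (M : 𝓗 →L[ℂ] 𝓗) (h : ℝ) (u₀ : 𝓗)
    (u : ℝ → 𝓗) : Prop where
  continuousOn : ContinuousOn u (Set.Icc 0 h)
  duhamel : ∀ τ ∈ Set.Icc 0 h,
    u τ = E τ u₀ - Complex.I • ∫ s in (0 : ℝ)..τ, E (τ - s) (M (u s))

/-- The (untwisted) Picard map `Φ`, with initial value `u₀`, applied to a vector `u` of values at
the nodes and evaluated at time `τ`. -/
noncomputable def picard {J : ℕ} (E : ℝ → 𝓗 ≃ₗᵢ[ℂ] 𝓗) (M : 𝓗 →L[ℂ] 𝓗) (t : Fin J → ℝ)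
    (u₀ : 𝓗) (u : Fin J → 𝓗) (τ : ℝ) : 𝓗 :=
  E τ u₀ - Complex.I • ∫ s in (0 : ℝ)..τ,
    ∑ m, (lagrange t m s : ℂ) • E (τ - t m) (M (u m))

/-- The vector of the values of `Φ u` at the nodes. -/
noncomputable def picardVec {J : ℕ} (E : ℝ → 𝓗 ≃ₗᵢ[ℂ] 𝓗) (M : 𝓗 →L[ℂ] 𝓗) (t : Fin J → ℝ)
    (u₀ : 𝓗) (u : Fin J → 𝓗) : Fin J → 𝓗 :=
  fun j => picard E M t u₀ u (t j)

/-- `u` solves the collocation equation `u = Φ (u(t₁), …, u(t_J))` on `[0, h]`. -/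
def IsCollocationSolution {J : ℕ} (E : ℝ → 𝓗 ≃ₗᵢ[ℂ] 𝓗) (M : 𝓗 →L[ℂ] 𝓗) (h : ℝ)
    (t : Fin J → ℝ) (u₀ : 𝓗) (u : ℝ → 𝓗) : Prop :=
  ∀ τ ∈ Set.Icc 0 h, u τ = picard E M t u₀ (fun m => u (t m)) τ

/-- The norm of `L^∞(0, h; 𝓗)`. -/
noncomputable def supNorm (h : ℝ) (u : ℝ → 𝓗) : ℝ :=
  (eLpNorm u ⊤ (volume.restrict (Set.Ioo 0 h))).toReal

end Iteration

/-- The iterates `u⁰ = 0`, `uᵏ⁺¹ = S_{α_k} (Φ uᵏ)` of the soft-thresholded Picard iteration, with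
thresholds `α_k = θ ^ k * α₀`, `α₀ = σ_max(u₀)`. -/
noncomputable def iterate {d₁ d₂ : ℕ} {Ω₁ : Set (Space d₁)} {Ω₂ : Set (Space d₂)} {J : ℕ}
    (E : ℝ → L2Prod Ω₁ Ω₂ ≃ₗᵢ[ℂ] L2Prod Ω₁ Ω₂) (M : L2Prod Ω₁ Ω₂ →L[ℂ] L2Prod Ω₁ Ω₂)
    (t : Fin J → ℝ) (θ : ℝ) (u₀ : L2Prod Ω₁ Ω₂) : ℕ → Fin J → L2Prod Ω₁ Ω₂
  | 0 => 0
  | k + 1 => fun j =>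
      softThreshold (θ ^ k * sigmaMax u₀) (picardVec E M t u₀ (iterate E M t θ u₀ k) j)

end LowRank

open LowRank

/-! Let `s = √ρ`, let `U` be the vector of values of the collocation solution at the nodes, and let
`κ = (1 - ρ) / (1 + ρ) * (ε / 4)`. The hypotheses say that, at every time in `[0, h]`, the exact
solution lies within `κ` of the collocation solution and within `κ` of its own soft thresholding at
`αbar`.

Two properties of soft thresholding carry the proof. It is firmly nonexpansive
(`SVD.norm_sq_add_le`), so both the thresholded part and the remainder are 1-Lipschitz functions of
the vector. Moreover, each of the `n` singular values above `α` contributes `α ^ 2` to the squared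
remainder, so that `n * α ^ 2 ≤ ‖v - S_α v‖ ^ 2` (`exists_rank_softThreshold_le`). A small remainder
therefore forces a small rank, and the remainder at a Picard image is controlled by the remainder at
the exact solution plus their distance.

The Picard map contracts with factor `ρ`, while the thresholds decrease only by `√ρ` per step, so
the contracted error never falls far behind the threshold. Before the stopping index the error
exceeds `ε / (1 + ρ)`, which keeps the threshold above `s * αbar`; there the remainder is at most `ε
/ s` times the threshold relative to `αbar` (`error_le_threshold`). Hence every iterate has rank at
most `rbar = ε ^ 2 / (ρ * αbar ^ 2)` (`exists_rank_iterate_le`).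

One Picard step adds at most `A = J * rank V * rbar` to the rank of the initial value. At the end
point this increment is removed again: the thresholding remainder at `αbar` is at most `β = ε / (1 -
ρ)`, so beyond index about `(1 + A) / ρ ^ 2` at most `A` small singular values are left, and their
squares sum to at most `(ρ * β) ^ 2 = δ ^ 2` (`rank_le_of_isRecompression`). -/

namespace LowRank

/-! ### Soft thresholding as a firmly nonexpansive map -/

section SingularValues
variable {X Y : Type*} [MeasurableSpace X] [MeasurableSpace Y]
  {μ : Measure X} {ν : Measure Y} [SigmaFinite μ] [SigmaFinite ν]

namespace SVD
variable {v w : Lp ℂ 2 (μ.prod ν)}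

theorem norm_e (s : SVD v) {k : ℕ} (hk : s.σ k ≠ 0) : ‖s.e k‖ = 1 :=
  s.orthonormal_left.1 ⟨k, hk⟩

theorem norm_f (s : SVD v) {k : ℕ} (hk : s.σ k ≠ 0) : ‖s.f k‖ = 1 :=
  s.orthonormal_right.1 ⟨k, hk⟩

/-- The singular vectors at zero singular values are arbitrary; requiring the coefficients to vanish
there is what makes the terms orthogonal. -/
theorem inner_term (s : SVD v) {c c' : ℕ → ℝ} (hc : ∀ k, s.σ k = 0 → c k = 0)
    (hc' : ∀ k, s.σ k = 0 → c' k = 0) (j k : ℕ) :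
    ⟪(c j : ℂ) • tensor (s.e j) (s.f j), (c' k : ℂ) • tensor (s.e k) (s.f k)⟫_ℂ =
      if j = k then ((c k * c' k : ℝ) : ℂ) else 0 := by
  rw [inner_smul_left, inner_smul_right, inner_tensor]
  by_cases hj : s.σ j = 0
  · rw [hc j hj]
    split_ifs with h
    · subst h; simp [hc j hj]
    · simp
  by_cases hk : s.σ k = 0
  · rw [hc' k hk]; simp
  split_ifs with h
  · subst h
    rw [inner_self_eq_norm_sq_to_K, inner_self_eq_norm_sq_to_K, s.norm_e hj, s.norm_f hj]
    simp
  · have : ⟪s.e j, s.e k⟫_ℂ = 0 :=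
      s.orthonormal_left.2 (i := ⟨j, hj⟩) (j := ⟨k, hk⟩) fun h' => h (congrArg Subtype.val h')
    simp [this]

theorem hasSum_inner (s : SVD v) {c c' : ℕ → ℝ} (hc : ∀ k, s.σ k = 0 → c k = 0)
    (hc' : ∀ k, s.σ k = 0 → c' k = 0) {p p' : Lp ℂ 2 (μ.prod ν)}
    (hp : HasSum (fun k => (c k : ℂ) • tensor (s.e k) (s.f k)) p)
    (hp' : HasSum (fun k => (c' k : ℂ) • tensor (s.e k) (s.f k)) p') :
    HasSum (fun k => c k * c' k) (RCLike.re ⟪p, p'⟫_ℂ) := by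
  have h1 : HasSum (fun k => ⟪p, (c' k : ℂ) • tensor (s.e k) (s.f k)⟫_ℂ) ⟪p, p'⟫_ℂ :=
    hp'.mapL (innerSL ℂ p)
  have h2 : ∀ k, ⟪p, (c' k : ℂ) • tensor (s.e k) (s.f k)⟫_ℂ = ((c k * c' k : ℝ) : ℂ) := by
    intro k
    have h3 := hp.mapL (innerSL ℂ ((c' k : ℂ) • tensor (s.e k) (s.f k)))
    have h4 : HasSum (fun j => if j = k then ((c k * c' k : ℝ) : ℂ) else 0)
        ⟪(c' k : ℂ) • tensor (s.e k) (s.f k), p⟫_ℂ := by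
      refine h3.congr_fun fun j => ?_
      rw [innerSL_apply_apply, s.inner_term hc' hc]
      by_cases h : j = k
      · subst h; simp [mul_comm]
      · simp [h, Ne.symm h]
    have h5 := h4.unique (hasSum_ite_eq k _)
    rw [← inner_conj_symm, h5, Complex.conj_ofReal]
  simp only [h2] at h1
  have h6 := Complex.hasSum_re h1
  simpa using h6

theorem hasSum_sq (s : SVD v) {c : ℕ → ℝ} (hc : ∀ k, s.σ k = 0 → c k = 0)
    {p : Lp ℂ 2 (μ.prod ν)} (hp : HasSum (fun k => (c k : ℂ) • tensor (s.e k) (s.f k)) p) :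
    HasSum (fun k => c k ^ 2) (‖p‖ ^ 2) := by
  have h := s.hasSum_inner hc hc hp hp
  rw [inner_self_eq_norm_sq] at h
  simpa only [sq] using h

theorem tendsto_zero (s : SVD v) : Filter.Tendsto s.σ Filter.atTop (nhds 0) := by
  have h := (s.hasSum_sq (fun _ h => h) s.hasSum).summable.tendsto_atTop_zero
  have h1 := (Real.continuous_sqrt.tendsto 0).comp h
  rw [Real.sqrt_zero] at h1
  exact h1.congr fun k => Real.sqrt_sq (s.nonneg k)

/-- Soft thresholding of a given singular value decomposition. -/
noncomputable def soft (s : SVD v) (α : ℝ) : Lp ℂ 2 (μ.prod ν) :=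
  ∑' k, ((max (s.σ k - α) 0 : ℝ) : ℂ) • tensor (s.e k) (s.f k)

theorem max_eq_zero (s : SVD v) {α : ℝ} (hα : 0 ≤ α) (k : ℕ) (hk : s.σ k = 0) :
    max (s.σ k - α) 0 = 0 := by
  rw [hk]; exact max_eq_right (by linarith)

theorem min_eq_zero (s : SVD v) {α : ℝ} (hα : 0 ≤ α) (k : ℕ) (hk : s.σ k = 0) :
    min (s.σ k) α = 0 := by
  rw [hk]; exact min_eq_left hα

theorem hasSum_soft (s : SVD v) {α : ℝ} (hα : 0 ≤ α) :
    HasSum (fun k => ((max (s.σ k - α) 0 : ℝ) : ℂ) • tensor (s.e k) (s.f k)) (s.soft α) := by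
  refine Summable.hasSum ?_
  -- For `α = 0` this is the series of `v` itself; for `α > 0` only finitely many terms are nonzero.
  rcases hα.eq_or_lt with rfl | hα
  · refine s.hasSum.summable.congr fun k => ?_
    rw [sub_zero, max_eq_left (s.nonneg k)]
  · obtain ⟨N, hN⟩ := Filter.eventually_atTop.1 (s.tendsto_zero.eventually (gt_mem_nhds hα))
    refine summable_of_ne_finset_zero (s := Finset.range N) fun k hk => ?_
    rw [Finset.mem_range, not_lt] at hk
    rw [max_eq_right (by linarith [hN k hk])]
    simp

theorem hasSum_sub_soft (s : SVD v) {α : ℝ} (hα : 0 ≤ α) :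
    HasSum (fun k => ((min (s.σ k) α : ℝ) : ℂ) • tensor (s.e k) (s.f k)) (v - s.soft α) := by
  refine (s.hasSum.sub (s.hasSum_soft hα)).congr_fun fun k => ?_
  rw [← sub_smul, ← Complex.ofReal_sub]
  congr 2
  rcases le_total (s.σ k) α with h | h
  · rw [min_eq_left h, max_eq_right (by linarith), sub_zero]
  · rw [min_eq_right h, max_eq_left (by linarith)]; ring

theorem hasSum_min_sq (s : SVD v) {α : ℝ} (hα : 0 ≤ α) :
    HasSum (fun k => min (s.σ k) α ^ 2) (‖v - s.soft α‖ ^ 2) :=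
  s.hasSum_sq (s.min_eq_zero hα) (s.hasSum_sub_soft hα)

theorem sum_min_sq_le (s : SVD v) {α : ℝ} (hα : 0 ≤ α) (n : ℕ) :
    ∑ k ∈ Finset.range n, min (s.σ k) α ^ 2 ≤ ‖v - s.soft α‖ ^ 2 :=
  sum_le_hasSum _ (fun _ _ => sq_nonneg _) (s.hasSum_min_sq hα)

/-- The remainder of soft thresholding has operator norm at most `α`. -/
theorem norm_inner_sub_soft_le (s : SVD v) {α : ℝ} (hα : 0 ≤ α) (a : Lp ℂ 2 μ) (b : Lp ℂ 2 ν) :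
    ‖⟪v - s.soft α, tensor a b⟫_ℂ‖ ≤ α * (‖a‖ * ‖b‖) := by
  have h1 : HasSum (fun k : {k // s.σ k ≠ 0} =>
      ((min (s.σ k) α : ℝ) : ℂ) • tensor (s.e k) (s.f k)) (v - s.soft α) := by
    refine (hasSum_subtype_iff_of_support_subset (s := {k | s.σ k ≠ 0}) fun k hk => ?_).2
      (s.hasSum_sub_soft hα)
    intro h
    apply hk
    simp only [s.min_eq_zero hα k h]
    simp
  have h2 := (h1.mapL (innerSL ℂ (tensor a b))).norm
  rw [innerSL_apply_apply] at h2
  rw [← inner_conj_symm, RCLike.norm_conj]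
  refine le_of_tendsto h2 (Filter.Eventually.of_forall fun F => ?_)
  have h3 : ∀ k ∈ F, ‖(innerSL ℂ (tensor a b)) (((min (s.σ k) α : ℝ) : ℂ) •
      tensor (s.e k) (s.f k))‖ ≤ α * (‖⟪s.e k, a⟫_ℂ‖ * ‖⟪s.f k, b⟫_ℂ‖) := by
    intro k _
    rw [innerSL_apply_apply, inner_smul_right, inner_tensor, norm_mul, norm_mul, Complex.norm_real,
      Real.norm_of_nonneg (le_min (s.nonneg k) hα), norm_inner_symm a, norm_inner_symm b]
    gcongr
    exact min_le_right _ _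
  refine (norm_sum_le_of_le F h3).trans ?_
  rw [← Finset.mul_sum]
  refine mul_le_mul_of_nonneg_left ?_ hα
  -- Cauchy-Schwarz, followed by Bessel's inequality for the left and for the right singular
  -- vectors.
  have h4 := Finset.sum_mul_sq_le_sq_mul_sq F (fun k => ‖⟪s.e k, a⟫_ℂ‖) (fun k => ‖⟪s.f k, b⟫_ℂ‖)
  have h5 := s.orthonormal_left.sum_inner_products_le a (s := F)
  have h6 := s.orthonormal_right.sum_inner_products_le b (s := F)
  refine abs_le_of_sq_le_sq' (h4.trans ?_) (by positivity) |>.2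
  rw [mul_pow]
  gcongr

/-- The remainder of `v` has operator norm at most `α`, so it pairs with `s'.soft α` to at most `α`
times the nuclear norm of the latter. The remainder of `w` attains this value, since its singular
values equal `α` wherever those of `s'.soft α` are nonzero. In other words, the remainder is a
subgradient of `α` times the nuclear norm at the thresholded vector. -/
theorem re_inner_sub_soft_le (s : SVD v) (s' : SVD w) {α : ℝ} (hα : 0 ≤ α) :
    RCLike.re ⟪v - s.soft α, s'.soft α⟫_ℂ ≤ RCLike.re ⟪w - s'.soft α, s'.soft α⟫_ℂ := by
  have h1 := Complex.hasSum_re ((s'.hasSum_soft hα).mapL (innerSL ℂ (v - s.soft α)))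
  have h2 := s'.hasSum_inner (s'.min_eq_zero hα) (s'.max_eq_zero hα)
    (s'.hasSum_sub_soft hα) (s'.hasSum_soft hα)
  refine hasSum_le (fun k => ?_) h1 h2
  rw [innerSL_apply_apply, inner_smul_right, Complex.re_ofReal_mul]
  rcases le_or_gt (s'.σ k) α with h | h
  · rw [max_eq_right (by linarith)]; simp
  · have hk : s'.σ k ≠ 0 := by linarith
    rw [mul_comm, min_eq_right h.le]
    refine mul_le_mul_of_nonneg_right ?_ (le_max_right _ _)
    have := s.norm_inner_sub_soft_le hα (s'.e k) (s'.f k)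
    rw [s'.norm_e hk, s'.norm_f hk, mul_one, mul_one] at this
    exact (Complex.re_le_norm _).trans this

/-- Monotonicity of the subdifferential: add the two subgradient inequalities. -/
theorem re_inner_nonneg (s : SVD v) (s' : SVD w) {α : ℝ} (hα : 0 ≤ α) :
    0 ≤ RCLike.re ⟪(v - s.soft α) - (w - s'.soft α), s.soft α - s'.soft α⟫_ℂ := by
  have h1 := s.re_inner_sub_soft_le s' hα
  have h2 := s'.re_inner_sub_soft_le s hα
  rw [inner_sub_left, inner_sub_right, inner_sub_right]
  simp only [map_sub]
  linarith

theorem norm_sq_add_le (s : SVD v) (s' : SVD w) {α : ℝ} (hα : 0 ≤ α) :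
    ‖(v - s.soft α) - (w - s'.soft α)‖ ^ 2 + ‖s.soft α - s'.soft α‖ ^ 2 ≤ ‖v - w‖ ^ 2 := by
  have h := s.re_inner_nonneg s' hα
  have h1 := norm_add_sq (𝕜 := ℂ) ((v - s.soft α) - (w - s'.soft α)) (s.soft α - s'.soft α)
  have h2 : (v - s.soft α) - (w - s'.soft α) + (s.soft α - s'.soft α) = v - w := by abel
  rw [h2] at h1
  linarith

theorem norm_soft_sub_le (s : SVD v) (s' : SVD w) {α : ℝ} (hα : 0 ≤ α) :
    ‖s.soft α - s'.soft α‖ ≤ ‖v - w‖ := by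
  have := s.norm_sq_add_le s' hα
  refine abs_le_of_sq_le_sq' ?_ (norm_nonneg _) |>.2
  nlinarith [sq_nonneg ‖(v - s.soft α) - (w - s'.soft α)‖]

theorem norm_remainder_sub_le (s : SVD v) (s' : SVD w) {α : ℝ} (hα : 0 ≤ α) :
    ‖(v - s.soft α) - (w - s'.soft α)‖ ≤ ‖v - w‖ := by
  have := s.norm_sq_add_le s' hα
  refine abs_le_of_sq_le_sq' ?_ (norm_nonneg _) |>.2
  nlinarith [sq_nonneg ‖s.soft α - s'.soft α‖]

/-- Nonexpansiveness, applied to two decompositions of one vector, shows that thresholding does not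
depend on the decomposition. -/
theorem soft_eq_softThreshold (s : SVD v) {α : ℝ} (hα : 0 ≤ α) :
    s.soft α = softThreshold α v := by
  have := s.norm_soft_sub_le (svd v) hα
  rw [sub_self, norm_zero] at this
  exact sub_eq_zero.1 (norm_le_zero_iff.1 this)

end SVD

variable {v w : Lp ℂ 2 (μ.prod ν)}

theorem norm_softThreshold_sub_le {α : ℝ} (hα : 0 ≤ α) (v w : Lp ℂ 2 (μ.prod ν)) :
    ‖softThreshold α v - softThreshold α w‖ ≤ ‖v - w‖ :=
  (svd v).norm_soft_sub_le (svd w) hα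

theorem norm_sub_softThreshold_le {α : ℝ} (hα : 0 ≤ α) (v w : Lp ℂ 2 (μ.prod ν)) :
    ‖v - softThreshold α v‖ ≤ ‖w - softThreshold α w‖ + ‖v - w‖ := by
  have h := (svd v).norm_remainder_sub_le (svd w) hα
  have h2 := norm_sub_norm_le (v - softThreshold α v) (w - softThreshold α w)
  change ‖(v - softThreshold α v) - (w - softThreshold α w)‖ ≤ _ at h
  linarith

theorem continuous_softThreshold {α : ℝ} (hα : 0 ≤ α) :
    Continuous (softThreshold α : Lp ℂ 2 (μ.prod ν) → Lp ℂ 2 (μ.prod ν)) :=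
  (LipschitzWith.of_dist_le_mul (K := 1) fun v w => by
    simpa [dist_eq_norm] using norm_softThreshold_sub_le hα v w).continuous

/-- The remainder of soft thresholding grows at most linearly in the threshold. -/
theorem norm_sub_softThreshold_le_max_mul {α β : ℝ} (hα : 0 < α) (hβ : 0 ≤ β)
    (v : Lp ℂ 2 (μ.prod ν)) :
    ‖v - softThreshold β v‖ ≤ max 1 (β / α) * ‖v - softThreshold α v‖ := by
  refine abs_le_of_sq_le_sq' ?_ (by positivity) |>.2
  rw [mul_pow]
  refine hasSum_le (fun k => ?_) ((svd v).hasSum_min_sq hβ)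
    (((svd v).hasSum_min_sq hα.le).mul_left (max 1 (β / α) ^ 2))
  have h0 := (svd v).nonneg k
  rw [← mul_pow]
  refine pow_le_pow_left₀ (le_min h0 hβ) ?_ 2
  rcases le_total ((svd v).σ k) α with h | h
  · rw [min_eq_left h]
    calc _ ≤ 1 * (svd v).σ k := by rw [one_mul]; exact min_le_left _ _
      _ ≤ _ := by gcongr; exact le_max_left _ _
  · rw [min_eq_right h]
    calc _ ≤ β / α * α := by rw [div_mul_cancel₀ _ hα.ne']; exact min_le_right _ _
      _ ≤ _ := by gcongr; exact le_max_right _ _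

end SingularValues

/-! ### Rank, singular values, and thresholding remainders -/

section Rank
variable {X Y : Type*} [MeasurableSpace X] [MeasurableSpace Y]
  {μ : Measure X} {ν : Measure Y} [SigmaFinite μ] [SigmaFinite ν]
  {v w : Lp ℂ 2 (μ.prod ν)}

theorem tensor_zero_left (g : Lp ℂ 2 ν) : (tensor (0 : Lp ℂ 2 μ) g : Lp ℂ 2 (μ.prod ν)) = 0 := by
  rw [← tensorₗ_apply]; simp

theorem smul_tensor (c : ℂ) (f : Lp ℂ 2 μ) (g : Lp ℂ 2 ν) :
    c • (tensor f g : Lp ℂ 2 (μ.prod ν)) = tensor (c • f) g := by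
  rw [← tensorₗ_apply, ← tensorₗ_apply]; simp

theorem rank_sum_tensor_le {ι : Type*} [Fintype ι] (f : ι → Lp ℂ 2 μ) (g : ι → Lp ℂ 2 ν) :
    rank (∑ i, tensor (f i) (g i) : Lp ℂ 2 (μ.prod ν)) ≤ Fintype.card ι := by
  let e := Fintype.equivFin ι
  refine iInf₂_le (Fintype.card ι) ⟨fun i => f (e.symm i), fun i => g (e.symm i), ?_⟩
  exact (e.symm.sum_comp fun i => (tensor (f i) (g i) : Lp ℂ 2 (μ.prod ν))).symm

theorem rank_le_iff {n : ℕ} : rank v ≤ n ↔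
    ∃ (f : Fin n → Lp ℂ 2 μ) (g : Fin n → Lp ℂ 2 ν), v = ∑ i, tensor (f i) (g i) := by
  constructor
  · intro h
    have h1 : rank v < ((n + 1 : ℕ) : ℕ∞) := lt_of_le_of_lt h (by exact_mod_cast Nat.lt_succ_self n)
    rw [rank, iInf_lt_iff] at h1
    obtain ⟨r, h1⟩ := h1
    rw [iInf_lt_iff] at h1
    obtain ⟨⟨f, g, hv⟩, h1⟩ := h1
    have hr : r ≤ n := Nat.lt_succ_iff.1 (by exact_mod_cast h1)
    -- Shorter sums are padded with zero tensors up to length `n`.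
    let F : ℕ → Lp ℂ 2 μ := fun k => if h : k < r then f ⟨k, h⟩ else 0
    let G : ℕ → Lp ℂ 2 ν := fun k => if h : k < r then g ⟨k, h⟩ else 0
    refine ⟨fun i => F i, fun i => G i, ?_⟩
    rw [Fin.sum_univ_eq_sum_range (fun k => (tensor (F k) (G k) : Lp ℂ 2 (μ.prod ν))) n,
      ← Finset.sum_subset (Finset.range_mono hr), ← Fin.sum_univ_eq_sum_range
      (fun k => (tensor (F k) (G k) : Lp ℂ 2 (μ.prod ν))) r, hv]
    · refine Finset.sum_congr rfl fun i _ => ?_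
      simp [F, G]
    · intro k _ hk
      have : F k = 0 := by simp [F, Finset.mem_range.not.1 hk]
      rw [this, tensor_zero_left]
  · rintro ⟨f, g, rfl⟩
    simpa using rank_sum_tensor_le f g

theorem rank_tensor_le (f : Lp ℂ 2 μ) (g : Lp ℂ 2 ν) :
    rank (tensor f g : Lp ℂ 2 (μ.prod ν)) ≤ 1 := by
  simpa using rank_sum_tensor_le (ι := Unit) (fun _ => f) (fun _ => g)

theorem rank_zero : rank (0 : Lp ℂ 2 (μ.prod ν)) = 0 := by
  have h := rank_sum_tensor_le (ι := Empty) (fun _ => (0 : Lp ℂ 2 μ)) (fun _ => (0 : Lp ℂ 2 ν))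
  simpa using h

theorem eq_zero_of_rank_eq_zero (h : rank v = 0) : v = 0 := by
  obtain ⟨f, g, hv⟩ := rank_le_iff.1 (h.le.trans_eq Nat.cast_zero.symm)
  simpa using hv

theorem rank_add_le (v w : Lp ℂ 2 (μ.prod ν)) : rank (v + w) ≤ rank v + rank w := by
  by_cases hv : rank v = ⊤
  · simp [hv]
  by_cases hw : rank w = ⊤
  · simp [hw]
  obtain ⟨m, hm⟩ := ENat.ne_top_iff_exists.1 hv
  obtain ⟨n, hn⟩ := ENat.ne_top_iff_exists.1 hw
  obtain ⟨f, g, h1⟩ := rank_le_iff.1 hm.ge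
  obtain ⟨f', g', h2⟩ := rank_le_iff.1 hn.ge
  rw [← hm, ← hn]
  have h := rank_sum_tensor_le (ι := Fin m ⊕ Fin n) (Sum.elim f f') (Sum.elim g g')
  simp only [Fintype.sum_sum_type, Sum.elim_inl, Sum.elim_inr, ← h1, ← h2] at h
  simpa using h

theorem rank_sum_le {ι : Type*} (s : Finset ι) (v : ι → Lp ℂ 2 (μ.prod ν)) :
    rank (∑ i ∈ s, v i) ≤ ∑ i ∈ s, rank (v i) := by
  classical
  induction s using Finset.induction_on with
  | empty => simp [rank_zero]
  | insert i s hi ih =>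
    rw [Finset.sum_insert hi, Finset.sum_insert hi]
    exact (rank_add_le _ _).trans (by gcongr)

/-- A linear map sending elementary tensors to tensors of rank at most `r` multiplies ranks by at
most `r`. -/
theorem rank_map_le (L : Lp ℂ 2 (μ.prod ν) →ₗ[ℂ] Lp ℂ 2 (μ.prod ν)) {r : ℕ∞}
    (hL : ∀ f g, rank (L (tensor f g)) ≤ r) (v : Lp ℂ 2 (μ.prod ν)) {n : ℕ} (hv : rank v ≤ n) :
    rank (L v) ≤ n * r := by
  obtain ⟨f, g, rfl⟩ := rank_le_iff.1 hv
  rw [map_sum]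
  refine (rank_sum_le _ _).trans ((Finset.sum_le_sum fun i _ => hL (f i) (g i)).trans ?_)
  simp

theorem rank_smul_le (c : ℂ) (v : Lp ℂ 2 (μ.prod ν)) : rank (c • v) ≤ rank v := by
  by_cases hv : rank v = ⊤
  · simp [hv]
  obtain ⟨n, hn⟩ := ENat.ne_top_iff_exists.1 hv
  rw [← hn]
  have := rank_map_le (LinearMap.lsmul ℂ _ c) (r := 1) (fun f g => by
    rw [LinearMap.lsmul_apply, smul_tensor]
    exact rank_tensor_le _ _) v hn.ge
  simpa using this

theorem rank_tensorUnitary_le (S : Lp ℂ 2 μ ≃ₗᵢ[ℂ] Lp ℂ 2 μ) (T : Lp ℂ 2 ν ≃ₗᵢ[ℂ] Lp ℂ 2 ν)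
    (v : Lp ℂ 2 (μ.prod ν)) : rank (tensorUnitary S T v) ≤ rank v := by
  by_cases hv : rank v = ⊤
  · simp [hv]
  obtain ⟨n, hn⟩ := ENat.ne_top_iff_exists.1 hv
  rw [← hn]
  have := rank_map_le (tensorUnitary S T).toLinearEquiv.toLinearMap (r := 1) (fun f g => by
    change rank (tensorUnitary S T (tensor f g)) ≤ 1
    rw [tensorUnitary_tensor]
    exact rank_tensor_le _ _) v hn.ge
  simpa using this

/-- A vector of rank at most `n` has at most `n` nonzero singular values. -/
theorem SVD.σ_eq_zero (s : SVD v) {n : ℕ} (hv : rank v ≤ n) {k : ℕ} (hk : n ≤ k) : s.σ k = 0 := by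
  suffices h : s.σ n = 0 from le_antisymm (h ▸ s.antitone hk) (s.nonneg k)
  by_contra hn
  have hpos : ∀ k ≤ n, s.σ k ≠ 0 := fun k hk =>
    ((lt_of_le_of_ne (s.nonneg n) (Ne.symm hn)).trans_le (s.antitone hk)).ne'
  obtain ⟨a, b, hab⟩ := rank_le_iff.1 hv
  -- Pairing `v` with `s.e k` in the first variable gives `s.σ k • s.f k` from the decomposition and
  -- a combination of the `b i` from the tensor sum. Thus `n + 1` orthonormal vectors would lie in
  -- the span of `n` vectors.
  have hf : ∀ k ≤ n, s.f k ∈ Submodule.span ℂ (Set.range b) := by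
    intro k hk
    have h1 : ∀ y, ⟪v, tensor (s.e k) y⟫_ℂ = (s.σ k : ℂ) * ⟪s.f k, y⟫_ℂ := by
      intro y
      rw [← inner_conj_symm]
      have h2 := s.hasSum.mapL (innerSL ℂ (tensor (s.e k) y))
      rw [innerSL_apply_apply] at h2
      have h3 : HasSum (fun j => if j = k then (s.σ k : ℂ) * ⟪y, s.f k⟫_ℂ else 0)
          ⟪tensor (s.e k) y, v⟫_ℂ := by
        refine h2.congr_fun fun j => ?_
        rw [innerSL_apply_apply, inner_smul_right, inner_tensor]
        split_ifs with h
        · subst h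
          rw [inner_self_eq_norm_sq_to_K, s.norm_e (hpos _ hk)]
          simp
        · by_cases hj : s.σ j = 0
          · simp [hj]
          · have : ⟪s.e k, s.e j⟫_ℂ = 0 := s.orthonormal_left.2 (i := ⟨k, hpos k hk⟩)
              (j := ⟨j, hj⟩) fun h' => h (congrArg Subtype.val h').symm
            simp [this]
      rw [h3.unique (hasSum_ite_eq k _), map_mul, Complex.conj_ofReal, inner_conj_symm]
    have h2 : (s.σ k : ℂ) • s.f k = ∑ i, ⟪s.e k, a i⟫_ℂ • b i := by
      refine ext_inner_right ℂ fun y => ?_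
      have h3 : ⟪v, tensor (s.e k) y⟫_ℂ = ⟪∑ i, tensor (a i) (b i), tensor (s.e k) y⟫_ℂ :=
        congrArg (fun x => ⟪x, tensor (s.e k) y⟫_ℂ) hab
      rw [inner_smul_left, Complex.conj_ofReal, ← h1 y, h3, sum_inner, sum_inner]
      refine Finset.sum_congr rfl fun i _ => ?_
      rw [inner_tensor, inner_smul_left, inner_conj_symm]
    have h3 : s.f k = (s.σ k : ℂ)⁻¹ • ∑ i, ⟪s.e k, a i⟫_ℂ • b i := by
      rw [← h2, smul_smul, inv_mul_cancel₀ (by exact_mod_cast hpos k hk), one_smul]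
    rw [h3]
    exact Submodule.smul_mem _ _ (Submodule.sum_mem _ fun i _ =>
      Submodule.smul_mem _ _ (Submodule.subset_span ⟨i, rfl⟩))
  have hli : LinearIndependent ℂ (fun k : Fin (n + 1) => s.f k) :=
    s.orthonormal_right.linearIndependent.comp
      (fun k : Fin (n + 1) => ⟨k, hpos k (Nat.lt_succ_iff.1 k.2)⟩)
      fun i j h => Fin.ext (congrArg Subtype.val h)
  have hli' : LinearIndependent ℂ (fun k : Fin (n + 1) =>
      (⟨s.f k, hf k (Nat.lt_succ_iff.1 k.2)⟩ : Submodule.span ℂ (Set.range b))) :=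
    LinearIndependent.of_comp (Submodule.subtype _) hli
  have := FiniteDimensional.span_of_finite ℂ (Set.finite_range b)
  have h1 := hli'.fintype_card_le_finrank
  have h2 := finrank_range_le_card (R := ℂ) b
  rw [Set.finrank] at h2
  simp only [Fintype.card_fin] at h1 h2
  omega

theorem SVD.rank_sum_range_le (s : SVD v) (c : ℕ → ℂ) (n : ℕ) :
    rank (∑ k ∈ Finset.range n, c k • tensor (s.e k) (s.f k)) ≤ n := by
  rw [← Fin.sum_univ_eq_sum_range (fun k => c k • tensor (s.e k) (s.f k)) n]
  simp only [smul_tensor]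
  exact rank_le_iff.2 ⟨_, _, rfl⟩

theorem rank_le_of_svd (s : SVD v) {n : ℕ} (h : s.σ n = 0) : rank v ≤ n := by
  have h1 : HasSum (fun k => (s.σ k : ℂ) • tensor (s.e k) (s.f k))
      (∑ k ∈ Finset.range n, (s.σ k : ℂ) • tensor (s.e k) (s.f k)) := by
    refine hasSum_sum_of_ne_finset_zero fun k hk => ?_
    rw [Finset.mem_range, not_lt] at hk
    have : s.σ k = 0 := le_antisymm (h ▸ s.antitone hk) (s.nonneg k)
    simp [this]
  rw [s.hasSum.unique h1]
  exact s.rank_sum_range_le _ n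

/-- The rank of a soft-thresholded vector, measured by the size of the remainder. -/
theorem exists_rank_softThreshold_le {α : ℝ} (hα : 0 < α) (v : Lp ℂ 2 (μ.prod ν)) :
    ∃ n : ℕ, rank (softThreshold α v) ≤ n ∧ n * α ^ 2 ≤ ‖v - softThreshold α v‖ ^ 2 := by
  classical
  let s := svd v
  have hex : ∃ n, s.σ n ≤ α := (s.tendsto_zero.eventually (ge_mem_nhds hα)).exists
  refine ⟨Nat.find hex, ?_, ?_⟩
  · have h1 : HasSum (fun k => ((max (s.σ k - α) 0 : ℝ) : ℂ) • tensor (s.e k) (s.f k))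
        (∑ k ∈ Finset.range (Nat.find hex),
          ((max (s.σ k - α) 0 : ℝ) : ℂ) • tensor (s.e k) (s.f k)) := by
      refine hasSum_sum_of_ne_finset_zero fun k hk => ?_
      rw [Finset.mem_range, not_lt] at hk
      rw [max_eq_right (by linarith [s.antitone hk, Nat.find_spec hex])]
      simp
    have h2 : softThreshold α v = _ := (s.hasSum_soft hα.le).unique h1
    rw [h2]
    exact s.rank_sum_range_le _ _
  · refine le_trans (le_of_eq ?_) (s.sum_min_sq_le hα.le (Nat.find hex))
    rw [← nsmul_eq_mul, ← Finset.card_range (Nat.find hex), ← Finset.sum_const, Finset.card_range]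
    refine Finset.sum_congr rfl fun k hk => ?_
    rw [min_eq_right (not_le.1 (Nat.find_min hex (Finset.mem_range.1 hk))).le]

theorem norm_sub_softThreshold_sq_le_of_rank_le {α : ℝ} (hα : 0 ≤ α) {n : ℕ} (hv : rank v ≤ n) :
    ‖v - softThreshold α v‖ ^ 2 ≤ n * α ^ 2 := by
  have h1 := (svd v).hasSum_min_sq hα
  have h2 : HasSum (fun k => min ((svd v).σ k) α ^ 2)
      (∑ k ∈ Finset.range n, min ((svd v).σ k) α ^ 2) := by
    refine hasSum_sum_of_ne_finset_zero fun k hk => ?_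
    rw [Finset.mem_range, not_lt] at hk
    rw [(svd v).min_eq_zero hα k ((svd v).σ_eq_zero hv hk)]
    simp
  change ‖v - (svd v).soft α‖ ^ 2 ≤ _
  rw [h1.unique h2, ← nsmul_eq_mul]
  refine (Finset.sum_le_card_nsmul _ _ (α ^ 2) fun k _ => ?_).trans_eq (by rw [Finset.card_range])
  exact pow_le_pow_left₀ (le_min ((svd v).nonneg k) hα) (min_le_right _ _) 2

/-- Lower semicontinuity of the rank. With `α = σ n > 0`, the remainder of `v` has norm at least
`√(n + 1) * α`, that of a vector of rank at most `n` has norm at most `√n * α`, and the remainder is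
1-Lipschitz; hence `v` keeps a positive distance from all such vectors. -/
theorem isClosed_rank_le (n : ℕ) : IsClosed {v : Lp ℂ 2 (μ.prod ν) | rank v ≤ n} := by
  refine isClosed_of_closure_subset fun v hv => ?_
  change rank v ≤ n
  refine rank_le_of_svd (svd v) ?_
  by_contra hne
  set α := (svd v).σ n with hαdef
  have hα : 0 < α := lt_of_le_of_ne ((svd v).nonneg n) (Ne.symm hne)
  have hs : Real.sqrt n < Real.sqrt (n + 1) := Real.sqrt_lt_sqrt (by positivity) (by linarith)
  obtain ⟨w, hw, hvw⟩ := Metric.mem_closure_iff.1 hv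
    ((Real.sqrt (n + 1) - Real.sqrt n) * α) (mul_pos (by linarith) hα)
  rw [dist_eq_norm] at hvw
  have h1 : Real.sqrt (n + 1) * α ≤ ‖v - softThreshold α v‖ := by
    refine abs_le_of_sq_le_sq' ?_ (norm_nonneg _) |>.2
    rw [mul_pow, Real.sq_sqrt (by positivity)]
    refine le_trans (le_of_eq ?_) ((svd v).sum_min_sq_le hα.le (n + 1))
    have : ∀ k ∈ Finset.range (n + 1), min ((svd v).σ k) α ^ 2 = α ^ 2 := fun k hk => by
      rw [min_eq_right ((svd v).antitone (Nat.lt_succ_iff.1 (Finset.mem_range.1 hk)))]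
    rw [Finset.sum_congr rfl this]
    simp
  have h2 : ‖w - softThreshold α w‖ ≤ Real.sqrt n * α := by
    refine abs_le_of_sq_le_sq' ?_ (by positivity) |>.2
    rw [mul_pow, Real.sq_sqrt (by positivity)]
    exact norm_sub_softThreshold_sq_le_of_rank_le hα.le hw
  have h3 := norm_sub_softThreshold_le hα.le v w
  linarith

end Rank

/-! ### Strong continuity of tensor products of groups, and multiplication by functions of finite
rank -/

section TensorContinuity
variable {X Y : Type*} [MeasurableSpace X] [MeasurableSpace Y]
  {μ : Measure X} {ν : Measure Y} [SigmaFinite μ] [SigmaFinite ν]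

variable (μ ν) in
/-- The map `(f, g) ↦ f ⊗ g` as a continuous bilinear map. -/
noncomputable def tensorL : Lp ℂ 2 μ →L[ℂ] Lp ℂ 2 ν →L[ℂ] Lp ℂ 2 (μ.prod ν) :=
  LinearMap.mkContinuous₂ (tensorₗ μ ν) 1 fun f g => by
    rw [tensorₗ_apply, norm_tensor, one_mul]

theorem tensorL_apply (f : Lp ℂ 2 μ) (g : Lp ℂ 2 ν) : tensorL μ ν f g = tensor f g := rfl

theorem continuous_tensorUnitary {S : ℝ → Lp ℂ 2 μ ≃ₗᵢ[ℂ] Lp ℂ 2 μ}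
    {T : ℝ → Lp ℂ 2 ν ≃ₗᵢ[ℂ] Lp ℂ 2 ν} (hS : ∀ f, Continuous fun t => S t f)
    (hT : ∀ g, Continuous fun t => T t g) (v : Lp ℂ 2 (μ.prod ν)) :
    Continuous fun t => tensorUnitary (S t) (T t) v := by
  refine isClosed_property (denseRange_tensorLift (μ := μ) (ν := ν))
    (p := fun v => Continuous fun t => tensorUnitary (S t) (T t) v) ?_ ?_ v
  -- Since all operators are isometries, approximating `v` approximates its orbit uniformly in time.
  · refine isClosed_of_closure_subset fun v hv => ?_
    refine continuous_of_uniform_approx_of_continuous fun U hU => ?_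
    obtain ⟨ε, hε, hεU⟩ := Metric.mem_uniformity_dist.1 hU
    obtain ⟨w, hw, hvw⟩ := Metric.mem_closure_iff.1 hv ε hε
    exact ⟨_, hw, fun t => hεU (by rw [LinearIsometryEquiv.dist_map]; exact hvw)⟩
  · intro x
    induction x with
    | zero => simpa using continuous_const
    | add x y hx hy => simp only [map_add]; exact hx.add hy
    | tmul f g =>
      have h : (fun t => tensorUnitary (S t) (T t) (tensorLift μ ν (f ⊗ₜ g))) =
          fun t => tensorL μ ν (S t f) (T t g) := by
        funext t
        simp only [tensorLift, TensorProduct.lift.tmul, tensorₗ_apply, tensorUnitary_tensor,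
          tensorL_apply]
      rw [h]
      exact ((tensorL μ ν).continuous.comp (hS f)).clm_apply (hT g)

theorem denseRange_simpleFunc {Z : Type*} [MeasurableSpace Z] {ξ : Measure Z} :
    DenseRange (Subtype.val : Lp.simpleFunc ℂ 2 ξ → Lp ℂ 2 ξ) :=
  (Lp.simpleFunc.dense (p := 2) (by simp)).denseRange_val

theorem memLp_top_simpleFunc {Z : Type*} [MeasurableSpace Z] {ξ : Measure Z}
    (f : Lp.simpleFunc ℂ 2 ξ) : MemLp (f : Lp ℂ 2 ξ) ⊤ ξ :=
  (memLp_congr_ae (Lp.simpleFunc.toSimpleFunc_eq_toFun f)).1 (SimpleFunc.memLp_top _ ξ)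

/-- Multiplication by a function of rank `n` maps elementary tensors to vectors of rank at most
`n`. -/
theorem rank_mul_tensor_le {V : Lp ℂ 2 (μ.prod ν)} {n : ℕ} (hn : rank V ≤ n)
    (M : Lp ℂ 2 (μ.prod ν) →L[ℂ] Lp ℂ 2 (μ.prod ν))
    (hM : ∀ w, M w =ᵐ[μ.prod ν] fun z => V z * w z) (f : Lp ℂ 2 μ) (g : Lp ℂ 2 ν) :
    rank (M (tensor f g)) ≤ n := by
  obtain ⟨a, b, hV⟩ := rank_le_iff.1 hn
  -- For general `f` in `L²` the products `f * a i` need not be in `L²`. They are for bounded `f`,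
  -- so simple functions come first, and closedness of the rank bound gives the rest by density.
  have hsimple : ∀ (f : Lp.simpleFunc ℂ 2 μ) (g : Lp.simpleFunc ℂ 2 ν),
      rank (M (tensor (f : Lp ℂ 2 μ) (g : Lp ℂ 2 ν))) ≤ n := by
    intro f g
    let af : Fin n → Lp ℂ 2 μ := fun i => ((Lp.memLp (a i)).mul (memLp_top_simpleFunc f) : MemLp _ 2 μ).toLp
    let bg : Fin n → Lp ℂ 2 ν := fun i => ((Lp.memLp (b i)).mul (memLp_top_simpleFunc g) : MemLp _ 2 ν).toLp
    have haf : ∀ i, af i =ᵐ[μ] fun x => (f : Lp ℂ 2 μ) x * a i x := fun i => MemLp.coeFn_toLp _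
    have hbg : ∀ i, bg i =ᵐ[ν] fun x => (g : Lp ℂ 2 ν) x * b i x := fun i => MemLp.coeFn_toLp _
    refine rank_le_iff.2 ⟨af, bg, Lp.ext ?_⟩
    have h1 := ae_all_iff.2 fun i => ae_fst (ν := ν) (haf i)
    have h2 := ae_all_iff.2 fun i => ae_snd (μ := μ) (hbg i)
    have h3 := ae_all_iff.2 fun i => coeFn_tensor (af i) (bg i)
    have h4 := ae_all_iff.2 fun i => coeFn_tensor (a i) (b i)
    have h5 : V =ᵐ[μ.prod ν] fun z => ∑ i, (tensor (a i) (b i) : Lp ℂ 2 (μ.prod ν)) z := by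
      rw [hV]
      filter_upwards [Lp.coeFn_finsetSum Finset.univ
        fun i => (tensor (a i) (b i) : Lp ℂ 2 (μ.prod ν))] with z hz
      rw [hz, Finset.sum_apply]
    filter_upwards [hM (tensor (f : Lp ℂ 2 μ) (g : Lp ℂ 2 ν)),
      coeFn_tensor (f : Lp ℂ 2 μ) (g : Lp ℂ 2 ν), h1, h2, h3, h4, h5,
      Lp.coeFn_finsetSum Finset.univ fun i => (tensor (af i) (bg i) : Lp ℂ 2 (μ.prod ν))]
      with z h h0 h1 h2 h3 h4 h5 h6
    rw [h, h0, h5, h6, Finset.sum_mul, Finset.sum_apply]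
    refine Finset.sum_congr rfl fun i _ => ?_
    rw [h3, h4, h1, h2]
    ring
  have hleft : ∀ (f : Lp ℂ 2 μ) (g : Lp.simpleFunc ℂ 2 ν),
      rank (M (tensor f (g : Lp ℂ 2 ν))) ≤ n := fun f g =>
    isClosed_property (denseRange_simpleFunc (ξ := μ)) (p := fun f => rank (M (tensor f (g : Lp ℂ 2 ν))) ≤ n)
      ((isClosed_rank_le n).preimage
        (M.continuous.comp ((tensorL μ ν).flip (g : Lp ℂ 2 ν)).continuous))
      (fun f => hsimple f g) f
  exact isClosed_property (denseRange_simpleFunc (ξ := ν)) (p := fun g => rank (M (tensor f g)) ≤ n)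
    ((isClosed_rank_le n).preimage (M.continuous.comp (tensorL μ ν f).continuous))
    (fun g => hleft f g) g

end TensorContinuity

/-! ### The multiplication operator -/

section Potential
variable {d₁ d₂ : ℕ} {Ω₁ : Set (Space d₁)} {Ω₂ : Set (Space d₂)}

theorem coeFn_potentialOp (V : L2Prod Ω₁ Ω₂) (hV : MemLp V ⊤ (prodMeasure Ω₁ Ω₂))
    (w : L2Prod Ω₁ Ω₂) :
    potentialOp V hV w =ᵐ[prodMeasure Ω₁ Ω₂] fun z => V z * w z := by
  have h := ContinuousLinearMap.coeFn_holder (r := 2) (ContinuousLinearMap.mul ℂ ℂ) (hV.toLp V) w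
  filter_upwards [h, hV.coeFn_toLp] with z h1 h2
  change (ContinuousLinearMap.holder 2 (ContinuousLinearMap.mul ℂ ℂ) (hV.toLp V) w) z = _
  rw [h1, h2]
  rfl

theorem norm_potentialOp_pos (V : L2Prod Ω₁ Ω₂) (hV : MemLp V ⊤ (prodMeasure Ω₁ Ω₂))
    (hV₀ : V ≠ 0) : 0 < ‖potentialOp V hV‖ := by
  rw [norm_pos_iff]
  intro h
  apply hV₀
  rw [Lp.eq_zero_iff_ae_eq_zero]
  -- Since `V` is itself in `L²`, it serves as test vector: `V * V = 0` almost everywhere forces `V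
  -- = 0`.
  have h1 := coeFn_potentialOp V hV V
  rw [h] at h1
  have h2 : (((0 : L2Prod Ω₁ Ω₂ →L[ℂ] L2Prod Ω₁ Ω₂) V : L2Prod Ω₁ Ω₂) : _ → ℂ)
      =ᵐ[prodMeasure Ω₁ Ω₂] 0 := Lp.coeFn_zero _ _ _
  filter_upwards [h1, h2] with z h1 h2
  rw [h2] at h1
  simpa using h1.symm

end Potential

/-! ### Lagrange polynomials and the averaged Lebesgue function -/

section Lagrange
variable {J : ℕ} {t : Fin J → ℝ}

theorem continuous_lagrange (t : Fin J → ℝ) (j : Fin J) : Continuous (lagrange t j) := by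
  unfold lagrange
  fun_prop

theorem sum_lagrange (hJ : 1 ≤ J) (ht : Function.Injective t) (s : ℝ) :
    ∑ m, lagrange t m s = 1 := by
  have : Nonempty (Fin J) := ⟨⟨0, hJ⟩⟩
  have h := congrArg (Polynomial.eval s)
    (Lagrange.sum_basis (s := Finset.univ) (v := t) ht.injOn Finset.univ_nonempty)
  rw [Polynomial.eval_finsetSum, Polynomial.eval_one] at h
  rw [← h]
  refine Finset.sum_congr rfl fun m _ => ?_
  rw [lagrange, Lagrange.basis, Polynomial.eval_prod]
  refine Finset.prod_congr rfl fun j _ => ?_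
  simp [Lagrange.basisDivisor, div_eq_inv_mul]

theorem mul_avgLebesgue {h : ℝ} (hh : 0 < h) (t : Fin J → ℝ) :
    h * avgLebesgue h t = ∑ m, ∫ s in (0 : ℝ)..h, |lagrange t m s| := by
  rw [avgLebesgue, ← mul_assoc, mul_one_div_cancel hh.ne', one_mul,
    intervalIntegral.integral_finsetSum]
  exact fun m _ => (continuous_lagrange t m).abs.intervalIntegrable _ _

/-- The Lagrange polynomials sum to one, so the Lebesgue function is at least one everywhere. This
is needed for `ρ > 0`. -/
theorem avgLebesgue_pos {h : ℝ} (hh : 0 < h) (hJ : 1 ≤ J) (ht : Function.Injective t) :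
    0 < avgLebesgue h t := by
  rw [avgLebesgue]
  have hc : Continuous fun s => ∑ m, |lagrange t m s| :=
    continuous_finsetSum _ fun m _ => (continuous_lagrange t m).abs
  refine mul_pos (by positivity) ?_
  refine intervalIntegral.intervalIntegral_pos_of_pos (hc.intervalIntegrable _ _) (fun s => ?_) hh
  have h1 := Finset.abs_sum_le_sum_abs (fun m => lagrange t m s) Finset.univ
  rw [sum_lagrange hJ ht, abs_one] at h1
  linarith

end Lagrange

/-! ### The Picard map: finite form, contraction, pointwise bounds -/

section Picard
variable {𝓗 : Type*} [NormedAddCommGroup 𝓗] [InnerProductSpace ℂ 𝓗] [CompleteSpace 𝓗]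
  {J : ℕ} {t : Fin J → ℝ} {E : ℝ → 𝓗 ≃ₗᵢ[ℂ] 𝓗} {M : 𝓗 →L[ℂ] 𝓗} {h : ℝ}

/-- The group factor does not depend on the integration variable, so the integral collapses to `J`
terms; this is why a Picard step raises the rank only by a finite amount. -/
theorem picard_eq (E : ℝ → 𝓗 ≃ₗᵢ[ℂ] 𝓗) (M : 𝓗 →L[ℂ] 𝓗) (t : Fin J → ℝ) (u₀ : 𝓗)
    (u : Fin J → 𝓗) (τ : ℝ) :
    picard E M t u₀ u τ = E τ u₀ - Complex.I • ∑ m,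
      ((∫ s in (0 : ℝ)..τ, lagrange t m s : ℝ) : ℂ) • E (τ - t m) (M (u m)) := by
  rw [picard, intervalIntegral.integral_finsetSum]
  · congr 2
    refine Finset.sum_congr rfl fun m _ => ?_
    rw [intervalIntegral.integral_smul_const, intervalIntegral.integral_ofReal]
  · intro m _
    refine Continuous.intervalIntegrable ?_ _ _
    exact (Complex.continuous_ofReal.comp (continuous_lagrange t m)).smul continuous_const

theorem continuous_picard (hE : ∀ v, Continuous fun τ => E τ v) (u₀ : 𝓗) (u : Fin J → 𝓗) :
    Continuous (picard E M t u₀ u) := by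
  rw [funext (picard_eq E M t u₀ u)]
  refine (hE u₀).sub (continuous_const.smul (continuous_finsetSum _ fun m _ => ?_))
  refine Continuous.smul (Complex.continuous_ofReal.comp ?_)
    ((hE (M (u m))).comp (continuous_id.sub continuous_const))
  exact intervalIntegral.continuous_primitive
    (fun a b => (continuous_lagrange t m).intervalIntegrable a b) 0

theorem norm_picard_sub_le (hh : 0 < h) (u₀ : 𝓗) (u w : Fin J → 𝓗) {τ : ℝ}
    (hτ : τ ∈ Set.Icc 0 h) :
    ‖picard E M t u₀ u τ - picard E M t u₀ w τ‖ ≤ h * avgLebesgue h t * ‖M‖ * ‖u - w‖ := by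
  rw [picard_eq, picard_eq, sub_sub_sub_cancel_left, ← smul_sub, norm_smul, Complex.norm_I, one_mul,
    ← Finset.sum_sub_distrib, mul_avgLebesgue hh, Finset.sum_mul, Finset.sum_mul]
  refine norm_sum_le_of_le _ fun m _ => ?_
  rw [← smul_sub, ← map_sub, ← map_sub, norm_smul, LinearIsometryEquiv.norm_map, Complex.norm_real,
    mul_assoc]
  have hi : ∀ a b, IntervalIntegrable (fun s => |lagrange t m s|) volume a b := fun a b =>
    (continuous_lagrange t m).abs.intervalIntegrable a b
  refine mul_le_mul ?_ ?_ (norm_nonneg _) ?_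
  · refine (intervalIntegral.norm_integral_le_integral_norm hτ.1).trans ?_
    exact intervalIntegral.integral_mono_interval le_rfl hτ.1 hτ.2
      (Filter.Eventually.of_forall fun _ => abs_nonneg _) (hi 0 h)
  · rw [norm_sub_rev u]
    refine (M.le_opNorm _).trans (mul_le_mul_of_nonneg_left ?_ (norm_nonneg _))
    exact norm_le_pi_norm (w - u) m
  · exact intervalIntegral.integral_nonneg hh.le fun _ _ => abs_nonneg _

theorem norm_picardVec_sub_le (hh : 0 < h) (ht : ∀ j, t j ∈ Set.Icc 0 h) {ρ : ℝ}
    (hρ : ρ = h * avgLebesgue h t * ‖M‖) (hρ₀ : 0 ≤ ρ) (u₀ : 𝓗) (u w : Fin J → 𝓗) :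
    ‖picardVec E M t u₀ u - picardVec E M t u₀ w‖ ≤ ρ * ‖u - w‖ := by
  rw [pi_norm_le_iff_of_nonneg (by positivity), hρ]
  exact fun j => norm_picard_sub_le hh u₀ u w (ht j)

/-- The `L^∞` norm of a continuous function dominates its values, also at the end points. -/
theorem norm_le_supNorm (hh : 0 < h) {w : ℝ → 𝓗} (hw : ContinuousOn w (Set.Icc 0 h)) {τ : ℝ}
    (hτ : τ ∈ Set.Icc 0 h) : ‖w τ‖ ≤ supNorm h w := by
  obtain ⟨C, hC⟩ := isCompact_Icc.exists_bound_of_continuousOn hw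
  have hfin : eLpNorm w ⊤ (volume.restrict (Set.Ioo 0 h)) ≠ ⊤ := by
    rw [eLpNorm_exponent_top]
    refine ne_top_of_le_ne_top ENNReal.ofReal_ne_top
      (eLpNormEssSup_le_of_ae_bound (C := C) ?_)
    filter_upwards [ae_restrict_mem measurableSet_Ioo] with s hs
    exact hC s (Set.Ioo_subset_Icc_self hs)
  have hae : ∀ᵐ s ∂volume.restrict (Set.Ioo 0 h), ‖w s‖ ≤ supNorm h w := by
    filter_upwards [ae_le_eLpNormEssSup (f := w) (μ := volume.restrict (Set.Ioo 0 h))] with s hs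
    rw [← eLpNorm_exponent_top] at hs
    have := ENNReal.toReal_mono hfin hs
    rwa [toReal_enorm] at this
  have hdense : ∀ s ∈ Set.Ioo 0 h, ‖w s‖ ≤ supNorm h w := by
    intro s hs
    by_contra! hlt
    have hws : ContinuousAt (fun s => ‖w s‖) s :=
      (hw.continuousAt (Icc_mem_nhds hs.1 hs.2)).norm
    have hev : ∀ᶠ r in nhds s, supNorm h w < ‖w r‖ ∧ r ∈ Set.Ioo 0 h :=
      (hws.eventually (lt_mem_nhds hlt)).and (isOpen_Ioo.mem_nhds hs)
    -- By continuity a violation at one interior point holds on a nonempty open set, which has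
    -- positive measure. The end points follow by taking closures.
    obtain ⟨O, hO, hOo, hsO⟩ := eventually_nhds_iff.1 hev
    have h0 : volume O = 0 := by
      rw [ae_restrict_iff' measurableSet_Ioo] at hae
      refine measure_mono_null (fun r hr => ?_) hae
      simp only [Set.mem_compl_iff, Set.mem_ofPred_eq]
      exact fun hc => absurd (hc (hO r hr).2) (not_le.2 (hO r hr).1)
    exact (hOo.measure_pos volume ⟨s, hsO⟩).ne' h0
  have hcl : IsClosed (Set.Icc 0 h ∩ (fun s => ‖w s‖) ⁻¹' Set.Iic (supNorm h w)) :=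
    hw.norm.preimage_isClosed_of_isClosed isClosed_Icc isClosed_Iic
  have hsub : Set.Icc 0 h ⊆ Set.Icc 0 h ∩ (fun s => ‖w s‖) ⁻¹' Set.Iic (supNorm h w) := by
    rw [← closure_Ioo hh.ne]
    refine closure_minimal (fun s hs => ?_) (by rw [closure_Ioo hh.ne]; exact hcl)
    exact ⟨subset_closure hs, hdense s hs⟩
  exact (hsub hτ).2

end Picard

/-! ### Unitary invariance of singular values, and recompression -/

section Thresholding
variable {X Y : Type*} [MeasurableSpace X] [MeasurableSpace Y]
  {μ : Measure X} {ν : Measure Y} [SigmaFinite μ] [SigmaFinite ν]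
  {v w : Lp ℂ 2 (μ.prod ν)}

/-- The image of a singular value decomposition under a tensor product of unitary operators. -/
noncomputable def SVD.map (s : SVD v) (S : Lp ℂ 2 μ ≃ₗᵢ[ℂ] Lp ℂ 2 μ)
    (T : Lp ℂ 2 ν ≃ₗᵢ[ℂ] Lp ℂ 2 ν) : SVD (tensorUnitary S T v) where
  σ := s.σ
  e k := S (s.e k)
  f k := T (s.f k)
  antitone := s.antitone
  nonneg := s.nonneg
  orthonormal_left := s.orthonormal_left.comp_linearIsometryEquiv S
  orthonormal_right := s.orthonormal_right.comp_linearIsometryEquiv T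
  hasSum := by
    have h := s.hasSum.mapL (tensorUnitary S T).toContinuousLinearEquiv.toContinuousLinearMap
    refine h.congr_fun fun k => ?_
    change _ = tensorUnitary S T ((s.σ k : ℂ) • tensor (s.e k) (s.f k))
    rw [map_smul, tensorUnitary_tensor]

theorem sigmaMax_nonneg (v : Lp ℂ 2 (μ.prod ν)) : 0 ≤ sigmaMax v := (svd v).nonneg 0

/-- Tensor products of unitaries preserve singular values, so none exceeds the threshold. It makes
the first thresholded iterate vanish. -/
theorem softThreshold_sigmaMax_tensorUnitary (S : Lp ℂ 2 μ ≃ₗᵢ[ℂ] Lp ℂ 2 μ)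
    (T : Lp ℂ 2 ν ≃ₗᵢ[ℂ] Lp ℂ 2 ν) (v : Lp ℂ 2 (μ.prod ν)) :
    softThreshold (sigmaMax v) (tensorUnitary S T v) = 0 := by
  rw [← ((svd v).map S T).soft_eq_softThreshold (sigmaMax_nonneg v), SVD.soft]
  refine (tsum_congr fun k => ?_).trans tsum_zero
  have h : ((svd v).map S T).σ k ≤ sigmaMax v := (svd v).antitone (Nat.zero_le k)
  rw [max_eq_right (by linarith)]
  simp

/-- A recompression of a vector of rank at most `r + q` has rank at most `r` if the soft
thresholding remainder is small. -/
theorem rank_le_of_isRecompression {δ a β : ℝ} (hw : IsRecompression δ v w) (ha : 0 < a) {r q : ℕ}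
    (hr : 0 < r) (hv : rank v ≤ (r + q : ℕ)) (hβ : ‖v - softThreshold a v‖ ≤ β)
    (hβr : β ^ 2 < (r + 1) * a ^ 2) (hq : q * β ^ 2 ≤ (r + q) * δ ^ 2) : rank w ≤ r := by
  obtain ⟨s, r', hr', rfl⟩ := hw
  refine (s.rank_sum_range_le _ r').trans ?_
  rw [Nat.cast_le]
  refine hr'.2 ?_
  have hsum : ∀ n, ∑ k ∈ Finset.range n, min (s.σ k) a ^ 2 ≤ β ^ 2 := fun n => by
    refine (s.sum_min_sq_le ha.le n).trans ?_
    rw [s.soft_eq_softThreshold ha.le]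
    gcongr
  -- Otherwise `r + 1` singular values of size at least `a` would make the squared remainder at
  -- least `(r + 1) * a ^ 2`.
  have hra : s.σ r < a := by
    by_contra! h
    have h1 : ∀ k ∈ Finset.range (r + 1), min (s.σ k) a ^ 2 = a ^ 2 := fun k hk => by
      rw [min_eq_right (h.trans (s.antitone (Nat.lt_succ_iff.1 (Finset.mem_range.1 hk))))]
    have h2 := hsum (r + 1)
    rw [Finset.sum_congr rfl h1, Finset.sum_const, Finset.card_range, nsmul_eq_mul] at h2
    push_cast at h2
    linarith
  have htail : ∑' k, s.σ (r + k) ^ 2 = ∑ k ∈ Finset.range q, s.σ (r + k) ^ 2 := by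
    refine tsum_eq_sum fun k hk => ?_
    rw [Finset.mem_range, not_lt] at hk
    rw [s.σ_eq_zero hv (by omega)]
    simp
  change ∑' k, s.σ (r + k) ^ 2 ≤ δ ^ 2
  rw [htail]
  set T := ∑ k ∈ Finset.range q, s.σ (r + k) ^ 2 with hT
  have h1 : T ≤ q * s.σ r ^ 2 := by
    rw [← nsmul_eq_mul]
    refine (Finset.sum_le_card_nsmul _ _ (s.σ r ^ 2) fun k _ => ?_).trans_eq
      (by rw [Finset.card_range])
    exact pow_le_pow_left₀ (s.nonneg _) (s.antitone (Nat.le_add_right r k)) 2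
  have h2 : r * s.σ r ^ 2 + T ≤ β ^ 2 := by
    refine le_trans ?_ (hsum (r + q))
    rw [Finset.sum_range_add]
    refine add_le_add ?_ (le_of_eq (Finset.sum_congr rfl fun k _ => ?_))
    · rw [← nsmul_eq_mul]
      refine (by rw [Finset.card_range] : r • s.σ r ^ 2 = _).trans_le
        (Finset.card_nsmul_le_sum (Finset.range r) _ (s.σ r ^ 2) fun k hk => ?_)
      exact pow_le_pow_left₀ (s.nonneg _)
        (le_min (s.antitone (Finset.mem_range.1 hk).le) hra.le) 2
    · rw [min_eq_left ((s.antitone (Nat.le_add_right r k)).trans hra.le)]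
  -- From `T ≤ q * σ r ^ 2` and `r * σ r ^ 2 + T ≤ β ^ 2` one gets `(r + q) * T ≤ q * β ^ 2`.
  have hrq : (0 : ℝ) < r + q := by positivity
  refine le_of_mul_le_mul_left (le_trans ?_ hq) hrq
  nlinarith [Nat.cast_nonneg (α := ℝ) q, Nat.cast_nonneg (α := ℝ) r,
    mul_le_mul_of_nonneg_left h1 (Nat.cast_nonneg (α := ℝ) r),
    mul_le_mul_of_nonneg_left h2 (Nat.cast_nonneg (α := ℝ) q)]

theorem coe_rank_le_ofReal {n : ℕ} {x : ℝ} (hv : rank v ≤ n) (hn : (n : ℝ) ≤ x) :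
    (rank v : ℝ≥0∞) ≤ ENNReal.ofReal x := by
  calc (rank v : ℝ≥0∞) ≤ ((n : ℕ∞) : ℝ≥0∞) := ENat.toENNReal_le.2 hv
    _ = ENNReal.ofReal n := by rw [ENat.toENNReal_coe, ENNReal.ofReal_natCast]
    _ ≤ _ := ENNReal.ofReal_le_ofReal hn

theorem exists_rank_le_of_coe_rank_le {x : ℝ} (hx : 0 ≤ x)
    (hv : (rank v : ℝ≥0∞) ≤ ENNReal.ofReal x) : ∃ n : ℕ, rank v ≤ n ∧ (n : ℝ) ≤ x := by
  have h : rank v ≠ ⊤ := by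
    intro h
    rw [h] at hv
    simp at hv
  obtain ⟨n, hn⟩ := ENat.ne_top_iff_exists.1 h
  refine ⟨n, hn.ge, ?_⟩
  rw [← hn, ENat.toENNReal_coe, ← ENNReal.ofReal_natCast] at hv
  exact (ENNReal.ofReal_le_ofReal_iff hx).1 hv

end Thresholding

/-! ### Errors against thresholds, and the ranks of the iterates -/

section Iterates

/-- Thresholds decreasing geometrically with ratio `s = √ρ` stay above a multiple of the errors, as
long as the errors exceed the tolerance. Here `x` are thresholds relative to the benchmark. -/
theorem error_le_threshold {s κ ε : ℝ} (hs₀ : 0 < s) (hs₁ : s < 1) (hε : 0 ≤ ε)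
    (hκ : κ = (1 - s ^ 2) / (1 + s ^ 2) * (ε / 4)) {x e : ℕ → ℝ} (hx : ∀ k, x (k + 1) = s * x k)
    (h0 : e 0 ≤ s ^ 2 * e 0 + κ + κ * max 1 (x 0))
    (hstep : ∀ k, e (k + 1) ≤ s ^ 2 * e k + κ + κ * max 1 (x k)) {K : ℕ}
    (hK : ∀ k < K, ε < (1 + s ^ 2) * e k) {k : ℕ} (hk : k < K) :
    0 < x k ∧ (κ * max 1 (x k) + (s ^ 2 * e k + κ)) * s ≤ ε * x k := by
  have hpos : (0 : ℝ) < 1 + s ^ 2 := by positivity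
  have hκ' : (1 + s ^ 2) * κ = (1 - s ^ 2) * (ε / 4) := by rw [hκ]; field_simp
  have hs2 : 0 < 1 - s ^ 2 := by nlinarith
  have hss : s ^ 2 < s := by nlinarith
  obtain ⟨y, hy⟩ : ∃ y : ℕ → ℝ, ∀ k, y k = (1 + s ^ 2) * e k := ⟨_, fun _ => rfl⟩
  have hys : ∀ k, y (k + 1) ≤ s ^ 2 * y k + (1 - s ^ 2) * (ε / 4) * (1 + max 1 (x k)) := by
    intro k
    rw [hy, hy, ← hκ']
    nlinarith [mul_le_mul_of_nonneg_left (hstep k) hpos.le]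
  have hy0 : y 0 ≤ ε / 4 * (1 + max 1 (x 0)) := by
    refine le_of_mul_le_mul_left ?_ hs2
    have := mul_le_mul_of_nonneg_left h0 hpos.le
    rw [hy, ← mul_assoc _ (ε / 4), ← hκ']
    nlinarith
  -- For `1 ≤ x k` the first bound reproduces itself exactly, because `s * (1 + s) + (1 - s ^ 2) = 1
  -- + s`. It is multiplied through by `s` so that it also fits `x (k + 1) = s * x k`.
  have key : ∀ k < K, s * y k ≤ ε / 4 * (s + (1 + s) * x k) ∧ s ≤ x k := by
    intro k
    induction k with
    | zero =>
      intro h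
      have h1 := hK 0 h
      rw [← hy] at h1
      have hx1 : 1 ≤ x 0 := by
        by_contra! hlt
        rw [max_eq_left hlt.le] at hy0
        linarith
      rw [max_eq_right hx1] at hy0
      refine ⟨?_, by linarith⟩
      have h2 := mul_le_mul_of_nonneg_left hy0 hs₀.le
      have h3 : 0 ≤ ε * x 0 := by positivity
      nlinarith
    | succ k ih =>
      intro h
      obtain ⟨h1, h2⟩ := ih (by omega)
      have h3 := hys k
      rcases le_or_gt 1 (x k) with h4 | h4
      · rw [max_eq_right h4] at h3
        rw [hx]
        refine ⟨?_, by nlinarith⟩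
        have h5 := mul_le_mul_of_nonneg_left h1 hs₀.le
        refine mul_le_mul_of_nonneg_left (h3.trans ?_) hs₀.le |>.trans_eq
          (b := s * (ε / 4 * (1 + (1 + s) * x k))) (by ring)
        nlinarith
      -- Once a threshold is below the benchmark, the next error satisfies `y (k + 1) ≤ ε / 4 * (2 +
      -- s) < ε`, up to equality for `ε = 0`, so the iteration would have stopped. Hence the last
      -- relevant `x` is still at least `s`.
      · exfalso
        rw [max_eq_left h4.le] at h3
        have h5 := hK (k + 1) h
        rw [← hy] at h5
        have h6 := mul_le_mul_of_nonneg_left h1 hs₀.le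
        have h7 : ε * (s * (1 + s) * x k) ≤ ε * (s * (1 + s) * 1) := by gcongr
        nlinarith
  obtain ⟨h1, h2⟩ := key k hk
  refine ⟨by linarith, le_of_mul_le_mul_left ?_ hpos⟩
  have h3 : (1 + s ^ 2) * ((κ * max 1 (x k) + (s ^ 2 * e k + κ)) * s) =
      s * ((1 - s ^ 2) * (ε / 4) * (1 + max 1 (x k))) + s ^ 2 * (s * y k) := by
    rw [hy, ← hκ']; ring
  rw [h3]
  have h4 := mul_le_mul_of_nonneg_left h1 (sq_nonneg s)
  have hx0 : 0 < x k := by linarith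
  have h8 : ε * x k ≤ (1 + s ^ 2) * (ε * x k) := by
    have : 0 ≤ ε * x k := by positivity
    nlinarith [mul_nonneg (sq_nonneg s) this]
  refine le_trans ?_ h8
  refine le_trans (add_le_add_right h4 _) ?_
  rcases le_or_gt 1 (x k) with h5 | h5
  · rw [max_eq_right h5]
    have : s * ((1 - s ^ 2) * (ε / 4) * (1 + x k)) + s ^ 2 * (ε / 4 * (s + (1 + s) * x k)) =
      ε / 4 * (s * 1 + s * (1 + s) * x k) := by ring
    rw [this]
    have h6 : ε / 4 * (s * 1 + s * (1 + s) * x k) ≤ ε / 4 * (1 * x k + 1 * (1 + 1) * x k) := by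
      gcongr
    nlinarith [mul_nonneg hε hx0.le]
  -- Here `s ≤ x k` is used, and the resulting factor `4` exhausts the constant in `κ`.
  · rw [max_eq_left h5.le]
    have : s * ((1 - s ^ 2) * (ε / 4) * (1 + 1)) + s ^ 2 * (ε / 4 * (s + (1 + s) * x k)) =
      ε / 4 * (s * (2 - s ^ 2) + s ^ 2 * (1 + s) * x k) := by ring
    rw [this]
    have h6 : ε / 4 * (s * (2 - s ^ 2) + s ^ 2 * (1 + s) * x k) ≤
        ε / 4 * (x k * 2 + 1 ^ 2 * (1 + 1) * x k) := by
      gcongr <;> nlinarith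
    linarith

variable {d₁ d₂ : ℕ} {Ω₁ : Set (Space d₁)} {Ω₂ : Set (Space d₂)} {J : ℕ}
  {E : ℝ → L2Prod Ω₁ Ω₂ ≃ₗᵢ[ℂ] L2Prod Ω₁ Ω₂} {M : L2Prod Ω₁ Ω₂ →L[ℂ] L2Prod Ω₁ Ω₂} {t : Fin J → ℝ}

theorem rank_picard_le (hE : ∀ τ v, rank (E τ v) ≤ rank v) {r : ℕ}
    (hM : ∀ f g, rank (M (tensor f g)) ≤ r) {u₀ : L2Prod Ω₁ Ω₂} {n₀ : ℕ} (h₀ : rank u₀ ≤ n₀)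
    {u : Fin J → L2Prod Ω₁ Ω₂} {n : Fin J → ℕ} (hu : ∀ m, rank (u m) ≤ n m) (τ : ℝ) :
    rank (picard E M t u₀ u τ) ≤ (n₀ + ∑ m, n m * r : ℕ) := by
  rw [picard_eq, sub_eq_add_neg, ← neg_smul]
  refine (rank_add_le _ _).trans ?_
  push_cast
  refine add_le_add ((hE _ _).trans h₀) ((rank_smul_le _ _).trans ((rank_sum_le _ _).trans ?_))
  refine Finset.sum_le_sum fun m _ => (rank_smul_le _ _).trans ((hE _ _).trans ?_)
  exact rank_map_le M.toLinearMap hM (u m) (hu m)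

/-- The iterate `k + 1` is thresholded at `x k * a`. Its remainder is compared with that of the
benchmark `w j` through the 1-Lipschitz property, and is at most `ε * x k / s`. In the rank bound
the factor `x k` cancels, which makes the result uniform in `k`. -/
theorem exists_rank_iterate_le {s κ ε a : ℝ} (hs₀ : 0 < s) (hs₁ : s < 1) (hε : 0 ≤ ε)
    (hκ : κ = (1 - s ^ 2) / (1 + s ^ 2) * (ε / 4)) (ha : 0 < a) {u₀ : L2Prod Ω₁ Ω₂}
    (hE : ∀ τ, softThreshold (sigmaMax u₀) (E τ u₀) = 0) {U w : Fin J → L2Prod Ω₁ Ω₂}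
    (hlip : ∀ z, ‖picardVec E M t u₀ z - U‖ ≤ s ^ 2 * ‖z - U‖)
    (hdist : ∀ j, ‖w j - U j‖ ≤ κ) (hthr : ∀ j, ‖w j - softThreshold a (w j)‖ ≤ κ) {K : ℕ}
    (hK : IsLeast {k : ℕ | ‖picardVec E M t u₀ (iterate E M t s u₀ k) - iterate E M t s u₀ k‖ ≤ ε}
      K) (k : ℕ) (hk : k ≤ K) (j : Fin J) :
    ∃ n : ℕ, rank (iterate E M t s u₀ k j) ≤ n ∧ n * (s ^ 2 * a ^ 2) ≤ ε ^ 2 := by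
  obtain ⟨v, hv⟩ : ∃ v, v = iterate E M t s u₀ := ⟨_, rfl⟩
  have hv_zero : v 0 = 0 := by rw [hv]; rfl
  have hv_succ : ∀ k j, v (k + 1) j = softThreshold (s ^ k * sigmaMax u₀)
      (picardVec E M t u₀ (v k) j) := fun k j => by rw [hv]; rfl
  rw [← hv] at hK ⊢
  clear hv
  have hα₀ : 0 ≤ sigmaMax u₀ := sigmaMax_nonneg u₀
  have hα : ∀ k, 0 ≤ s ^ k * sigmaMax u₀ := fun k => by positivity
  have hκ₀ : 0 ≤ κ := (norm_nonneg _).trans (hdist j)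
  obtain ⟨x, hx⟩ : ∃ x : ℕ → ℝ, ∀ k, x k = s ^ k * sigmaMax u₀ / a := ⟨_, fun _ => rfl⟩
  have hthr' : ∀ k j, ‖w j - softThreshold (s ^ k * sigmaMax u₀) (w j)‖ ≤ κ * max 1 (x k) := by
    intro k j
    rw [hx, mul_comm κ]
    exact (norm_sub_softThreshold_le_max_mul ha (hα k) (w j)).trans
      (mul_le_mul_of_nonneg_left (hthr j) (by positivity))
  have hpic : ∀ k j, ‖picardVec E M t u₀ (v k) j - U j‖ ≤ s ^ 2 * ‖v k - U‖ := fun k j =>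
    (norm_le_pi_norm (picardVec E M t u₀ (v k) - U) j).trans (hlip (v k))
  have hstep : ∀ k, ‖v (k + 1) - U‖ ≤ s ^ 2 * ‖v k - U‖ + κ + κ * max 1 (x k) := by
    intro k
    rw [pi_norm_le_iff_of_nonneg (by positivity)]
    intro j
    rw [Pi.sub_apply, hv_succ]
    have h1 := norm_softThreshold_sub_le (hα k) (picardVec E M t u₀ (v k) j) (U j)
    have h2 := norm_sub_softThreshold_le (hα k) (U j) (w j)
    have h3 := norm_sub_le_norm_sub_add_norm_sub
      (softThreshold (s ^ k * sigmaMax u₀) (picardVec E M t u₀ (v k) j))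
      (softThreshold (s ^ k * sigmaMax u₀) (U j)) (U j)
    rw [norm_sub_rev (softThreshold _ (U j)) (U j)] at h3
    rw [norm_sub_rev (U j) (w j)] at h2
    linarith [hpic k j, hthr' k j, hdist j]
  -- The first threshold is the largest singular value of `u₀`, so `v 1 = v 0`. The error recursion
  -- at index `0` then bounds the initial error in terms of itself.
  have hv_one : v 1 = 0 := by
    funext j
    have h1 : picardVec E M t u₀ (v 0) j = E (t j) u₀ := by
      rw [picardVec, hv_zero, picard_eq]
      simp
    rw [hv_succ, h1, pow_zero, one_mul, hE]
    rfl
  have hresid : ∀ k, ‖picardVec E M t u₀ (v k) - v k‖ ≤ (1 + s ^ 2) * ‖v k - U‖ := by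
    intro k
    have h1 := norm_sub_le_norm_sub_add_norm_sub (picardVec E M t u₀ (v k)) U (v k)
    rw [norm_sub_rev U] at h1
    linarith [hlip (v k)]
  rcases k with _ | k
  · exact ⟨0, by rw [hv_zero]; simpa using rank_zero.le, by simpa using sq_nonneg ε⟩
  have hbound : 0 < x k ∧ (κ * max 1 (x k) + (s ^ 2 * ‖v k - U‖ + κ)) * s ≤ ε * x k := by
    refine error_le_threshold (κ := κ) (x := x) (e := fun k => ‖v k - U‖) hs₀ hs₁ hε hκ
      (fun k => ?_) ?_ hstep (K := K) (fun k hk => ?_) hk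
    · rw [hx, hx, pow_succ]; ring
    · have h1 := hstep 0
      rwa [zero_add, hv_one, ← hv_zero] at h1
    -- Minimality of `K`: before stopping the residual exceeds `ε`, hence so does `1 + s ^ 2` times
    -- the error.
    · refine lt_of_lt_of_le ?_ (hresid k)
      by_contra! hle
      exact absurd (hK.2 hle) (not_le.2 hk)
  obtain ⟨hx0, hb⟩ := hbound
  have hαk : s ^ k * sigmaMax u₀ = x k * a := by rw [hx, div_mul_cancel₀ _ ha.ne']
  have hαk₀ : 0 < x k * a := by positivity
  obtain ⟨n, hn, hnα⟩ := exists_rank_softThreshold_le hαk₀ (picardVec E M t u₀ (v k) j)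
  refine ⟨n, by rw [hv_succ, hαk]; exact hn, ?_⟩
  have h1 := norm_sub_softThreshold_le hαk₀.le (picardVec E M t u₀ (v k) j) (w j)
  have h2 := norm_sub_le_norm_sub_add_norm_sub (picardVec E M t u₀ (v k) j) (U j) (w j)
  have h3 := hthr' k j
  have h4 := hdist j
  rw [norm_sub_rev] at h4
  rw [hαk] at h3
  have h5 : ‖picardVec E M t u₀ (v k) j - softThreshold (x k * a) (picardVec E M t u₀ (v k) j)‖ * s
      ≤ ε * x k :=
    (mul_le_mul_of_nonneg_right (by linarith [hpic k j]) hs₀.le).trans hb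
  have h6 := pow_le_pow_left₀ (by positivity) h5 2
  rw [mul_pow, mul_pow] at h6
  have h7 := mul_le_mul_of_nonneg_right hnα (sq_nonneg s)
  refine le_of_mul_le_mul_right ?_ (by positivity : 0 < x k ^ 2)
  exact (le_of_eq (by ring)).trans (h7.trans h6)

end Iterates
end LowRank

/-! ### The rank bounds of the proposition -/

theorem proposition4p9
    -- the product domain and self-adjoint realizations of the two Laplacians
    {d₁ d₂ : ℕ} {Ω₁ : Set (Space d₁)} {Ω₂ : Set (Space d₂)} (hΩ₁ : IsOpen Ω₁) (hΩ₂ : IsOpen Ω₂)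
    (Δ₁ : L2 Ω₁ →ₗ.[ℂ] L2 Ω₁) (Δ₂ : L2 Ω₂ →ₗ.[ℂ] L2 Ω₂)
    (hΔ₁ : IsLaplacian Δ₁) (hΔ₂ : IsLaplacian Δ₂)
    (U₁ : ℝ → L2 Ω₁ ≃ₗᵢ[ℂ] L2 Ω₁) (U₂ : ℝ → L2 Ω₂ ≃ₗᵢ[ℂ] L2 Ω₂)
    (hU₁ : IsUnitaryGroup Δ₁ U₁) (hU₂ : IsUnitaryGroup Δ₂ U₂)
    (E : ℝ → L2Prod Ω₁ Ω₂ ≃ₗᵢ[ℂ] L2Prod Ω₁ Ω₂) (hE : E = productGroup U₁ U₂)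
    -- the bounded nonzero potential of finite rank
    (V : L2Prod Ω₁ Ω₂) (hV : MemLp V ⊤ (prodMeasure Ω₁ Ω₂)) (hV₀ : V ≠ 0) (hVr : rank V ≠ ⊤)
    (M : L2Prod Ω₁ Ω₂ →L[ℂ] L2Prod Ω₁ Ω₂) (hM : M = potentialOp V hV)
    -- the nodes and the contraction constant
    {J : ℕ} (hJ : 1 ≤ J) (h : ℝ) (hh : 0 < h) (t : Fin J → ℝ) (ht : IsGaussLegendre h t)
    (ρ : ℝ) (hρ_def : ρ = h * avgLebesgue h t * ‖M‖) (hρ : ρ ≤ 1 / 2)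
    -- the exact solution and the collocation solution
    (uInit uStarInit : L2Prod Ω₁ Ω₂) (u uStar : ℝ → L2Prod Ω₁ Ω₂)
    (hu : IsSchrodingerSolution E M h uInit u)
    (huStar : IsCollocationSolution E M h t uStarInit uStar)
    -- the tolerances
    (ε δ : ℝ) (hε : 4 * ((1 + ρ) / (1 - ρ)) * supNorm h (fun τ => u τ - uStar τ) ≤ ε)
    (hδ : δ = ρ * ε / (1 - ρ))
    -- the benchmark rank
    (αbar : ℝ) (hαbar_pos : 0 < αbar)
    (hαbar : supNorm h (fun τ => u τ - softThreshold αbar (u τ)) = (1 - ρ) / (1 + ρ) * (ε / 4))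
    (rbar : ℝ) (hrbar : rbar = ε ^ 2 / (ρ * αbar ^ 2))
    -- the iterates, the stopping index and the recompressed boundary value
    (v : ℕ → Fin J → L2Prod Ω₁ Ω₂) (hv : v = iterate E M t (Real.sqrt ρ) uStarInit)
    (K : ℕ) (hK : IsLeast {k : ℕ | ‖picardVec E M t uStarInit (v k) - v k‖ ≤ ε} K)
    (uTilde : L2Prod Ω₁ Ω₂) (huTilde : IsRecompression δ (picard E M t uStarInit (v K) h) uTilde)
    -- the bound on the initial rank
    (hinit : (rank uStarInit : ℝ≥0∞) ≤
      ENNReal.ofReal ((1 + J * (rank V).toNat * rbar) / ρ ^ 2)) :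
    (rank uTilde : ℝ≥0∞) ≤ ENNReal.ofReal ((1 + J * (rank V).toNat * rbar) / ρ ^ 2) ∧
    ∀ k ≤ K, ∀ j : Fin J,
      (rank (v k j) : ℝ≥0∞) ≤
        ENNReal.ofReal ((1 + ρ ^ 2) / ρ ^ 2 * (1 + J * (rank V).toNat * rbar)) ∧
      (rank (picardVec E M t uStarInit (v k) j) : ℝ≥0∞) ≤
        ENNReal.ofReal ((1 + ρ ^ 2) / ρ ^ 2 * (1 + J * (rank V).toNat * rbar)) := by
  have hinj : Function.Injective t := ht.strictMono.injective
  have hρ₀ : 0 < ρ := by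
    rw [hρ_def, hM]
    exact mul_pos (mul_pos hh (avgLebesgue_pos hh hJ hinj)) (norm_potentialOp_pos V hV hV₀)
  have hEc : ∀ w, Continuous fun τ => E τ w := fun w => by
    rw [hE]
    exact continuous_tensorUnitary hU₁.continuous hU₂.continuous w
  have hEr : ∀ τ w, rank (E τ w) ≤ rank w := fun τ w => by
    rw [hE]
    exact rank_tensorUnitary_le _ _ w
  obtain ⟨rV, hrV⟩ := ENat.ne_top_iff_exists.1 hVr
  have hMr : ∀ f g, rank (M (tensor f g)) ≤ rV := fun f g => by
    rw [hM]
    exact rank_mul_tensor_le hrV.ge _ (coeFn_potentialOp V hV) f g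
  have hrV' : (rank V).toNat = rV := by rw [← hrV]; rfl
  rw [hrV'] at hinit ⊢
  -- Together with `1 ≤ J` this gives `rbar ≤ A` below.
  have hrV₁ : 1 ≤ rV := Nat.one_le_iff_ne_zero.2 fun h0 =>
    hV₀ (eq_zero_of_rank_eq_zero (by rw [← hrV, h0]; rfl))
  -- the square root of the contraction constant
  obtain ⟨s, hs⟩ : ∃ s, s = Real.sqrt ρ := ⟨_, rfl⟩
  have hs₀ : 0 < s := hs ▸ Real.sqrt_pos.2 hρ₀
  have hs2 : s ^ 2 = ρ := by rw [hs, Real.sq_sqrt hρ₀.le]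
  have hs₁ : s < 1 := by rw [hs, Real.sqrt_lt' one_pos]; linarith
  rw [← hs] at hv
  -- the distances of exact, collocation and thresholded solutions
  obtain ⟨κ, hκ⟩ : ∃ κ, κ = (1 - ρ) / (1 + ρ) * (ε / 4) := ⟨_, rfl⟩
  have h1ρ : 0 < 1 - ρ := by linarith
  have hκ₀ : 0 ≤ κ := by rw [hκ, ← hαbar]; exact ENNReal.toReal_nonneg
  -- The sign of `ε` comes from `hαbar`, where a norm equals a positive multiple of `ε`.
  have hε₀ : 0 ≤ ε := by
    by_contra! hneg
    have : κ < 0 := by rw [hκ]; exact mul_neg_of_pos_of_neg (by positivity) (by linarith)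
    linarith
  have hκε : 4 * κ ≤ ε := by
    have h1 : (1 - ρ) / (1 + ρ) ≤ 1 := (div_le_one (by linarith)).2 (by linarith)
    rw [hκ]
    linarith [mul_le_mul_of_nonneg_right h1 (by linarith : 0 ≤ ε / 4)]
  have huStarc : ContinuousOn uStar (Set.Icc 0 h) :=
    (continuous_picard hEc uStarInit (fun m => uStar (t m))).continuousOn.congr huStar
  have huc := hu.continuousOn
  have hdist : ∀ τ ∈ Set.Icc 0 h, ‖u τ - uStar τ‖ ≤ κ := by
    intro τ hτ
    have h1 := norm_le_supNorm hh (huc.sub huStarc) hτ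
    refine h1.trans ?_
    change supNorm h (fun τ => u τ - uStar τ) ≤ κ
    rw [hκ, div_mul_eq_mul_div, le_div_iff₀ (by linarith)]
    rw [mul_div_assoc', div_mul_eq_mul_div, div_le_iff₀ h1ρ] at hε
    linarith
  have hthr : ∀ τ ∈ Set.Icc 0 h, ‖u τ - softThreshold αbar (u τ)‖ ≤ κ := by
    intro τ hτ
    have h1 := norm_le_supNorm hh
      (huc.sub ((continuous_softThreshold hαbar_pos.le).comp_continuousOn huc)) hτ
    refine h1.trans_eq ?_
    rw [hκ, ← hαbar]
    rfl
  -- the collocation solution is a fixed point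
  obtain ⟨U, hU⟩ : ∃ U : Fin J → L2Prod Ω₁ Ω₂, U = fun m => uStar (t m) := ⟨_, rfl⟩
  have hfix : picardVec E M t uStarInit U = U := by
    rw [hU]
    exact funext fun j => (huStar _ (ht.mem_Icc j)).symm
  have hlip : ∀ w, ‖picardVec E M t uStarInit w - U‖ ≤ ρ * ‖w - U‖ := fun w => by
    have h1 := norm_picardVec_sub_le (E := E) hh ht.mem_Icc hρ_def hρ₀.le uStarInit w U
    rwa [hfix] at h1
  have hrbar₀ : 0 ≤ rbar := by rw [hrbar]; positivity
  have hrbar_mul : rbar * (ρ * αbar ^ 2) = ε ^ 2 := by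
    rw [hrbar, div_mul_cancel₀ _ (by positivity)]
  have hiter : ∀ k ≤ K, ∀ j, ∃ n : ℕ, rank (v k j) ≤ n ∧ (n : ℝ) ≤ rbar := by
    intro k hk j
    rw [hv] at hK ⊢
    obtain ⟨n, hn, hnε⟩ := exists_rank_iterate_le hs₀ hs₁ hε₀ (hs2.symm ▸ hκ) hαbar_pos
      (fun τ => by rw [hE]; exact softThreshold_sigmaMax_tensorUnitary _ _ _) (hs2.symm ▸ hlip)
      (fun j => by rw [hU]; exact hdist _ (ht.mem_Icc j)) (fun j => hthr _ (ht.mem_Icc j)) hK k hk j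
    refine ⟨n, hn, ?_⟩
    rw [hs2, ← hrbar_mul] at hnε
    exact le_of_mul_le_mul_right hnε (by positivity)
  -- ranks of the Picard images
  obtain ⟨A, hA⟩ : ∃ A : ℝ, A = J * rV * rbar := ⟨_, rfl⟩
  rw [← hA] at hinit ⊢
  have hJ' : (1 : ℝ) ≤ J := by exact_mod_cast hJ
  have hrV₁' : (1 : ℝ) ≤ rV := by exact_mod_cast hrV₁
  have hrA : rbar ≤ A := by
    rw [hA]
    exact le_mul_of_one_le_left hrbar₀ (one_le_mul_of_one_le_of_one_le hJ' hrV₁')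
  have hA₀ : 0 ≤ A := hrbar₀.trans hrA
  have hsq : ρ ^ 2 ≤ 1 / 4 := (pow_le_pow_left₀ hρ₀.le hρ 2).trans_eq (by norm_num)
  obtain ⟨R, hR⟩ : ∃ R, R = (1 + A) / ρ ^ 2 := ⟨_, rfl⟩
  have hRρ : R * ρ ^ 2 = 1 + A := by rw [hR, div_mul_cancel₀ _ (by positivity)]
  have hR4 : 4 * (1 + A) ≤ R := by
    rw [hR, le_div_iff₀ (by positivity)]
    exact (mul_le_mul_of_nonneg_left hsq (by linarith)).trans_eq (by ring)
  have hRR : (1 + ρ ^ 2) / ρ ^ 2 * (1 + A) = R + 1 + A := by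
    rw [hR]; field_simp; ring
  rw [hRR, ← hR]
  rw [← hR] at hinit
  obtain ⟨n₀, hn₀, hn₀R⟩ := exists_rank_le_of_coe_rank_le (by linarith) hinit
  have hpic : ∀ k ≤ K, ∃ q : ℕ, (q : ℝ) ≤ A ∧
      ∀ τ, rank (picard E M t uStarInit (v k) τ) ≤ (n₀ + q : ℕ) := by
    intro k hk
    choose n hn hnr using hiter k hk
    refine ⟨∑ m, n m * rV, ?_, rank_picard_le hEr hMr hn₀ hn⟩
    push_cast
    refine (Finset.sum_le_card_nsmul _ _ (rbar * rV) fun m _ => ?_).trans_eq ?_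
    · gcongr
      exact hnr m
    · rw [Finset.card_univ, Fintype.card_fin, nsmul_eq_mul, hA]; ring
  refine ⟨?_, fun k hk j => ⟨?_, ?_⟩⟩
  · obtain ⟨q, hqA, hq⟩ := hpic K le_rfl
    have hfl := Nat.lt_floor_add_one R
    have hR₀ : 0 ≤ R := by linarith
    have hfl' := Nat.floor_le hR₀
    set r := ⌊R⌋₊ with hr
    refine coe_rank_le_ofReal (n := r) ?_ hfl'
    have hh' : h ∈ Set.Icc 0 h := ⟨hh.le, le_rfl⟩
    -- The a posteriori error bound for a `ρ`-contraction with residual at most `ε`; it satisfies `β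
    -- = ε + ρ * β`.
    obtain ⟨β, hβ⟩ : ∃ β, β = ε / (1 - ρ) := ⟨_, rfl⟩
    have hβε : β * (1 - ρ) = ε := by rw [hβ, div_mul_cancel₀ _ h1ρ.ne']
    have hβ₀ : 0 ≤ β := by rw [hβ]; positivity
    have hδβ : δ = ρ * β := by rw [hδ, hβ, mul_div_assoc]
    have hβ2 : β ≤ 2 * ε := by
      rw [← hβε]
      linarith [mul_le_mul_of_nonneg_left (by linarith : 1 / 2 ≤ 1 - ρ) hβ₀]
    have hε2 : β ^ 2 ≤ 4 * ε ^ 2 := (pow_le_pow_left₀ hβ₀ hβ2 2).trans_eq (by ring)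
    refine rank_le_of_isRecompression (β := β) (q := q) huTilde hαbar_pos ?_
      ((hq h).trans ?_) ?_ ?_ ?_
    · exact Nat.floor_pos.2 (by linarith)
    · exact_mod_cast Nat.add_le_add_right (Nat.le_floor hn₀R) q
    · have h1 := norm_sub_softThreshold_le hαbar_pos.le (picard E M t uStarInit (v K) h) (u h)
      have h2 := hthr h hh'
      have h3 := hdist h hh'
      rw [norm_sub_rev] at h3
      have h4 := norm_picard_sub_le (E := E) (M := M) (t := t) hh uStarInit (v K) U hh'
      rw [← hρ_def, hU, ← huStar h hh', ← hU] at h4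
      have h5 := norm_sub_le_norm_sub_add_norm_sub (picard E M t uStarInit (v K) h) (uStar h) (u h)
      have h6 := norm_sub_le_norm_sub_add_norm_sub (v K) (picardVec E M t uStarInit (v K)) U
      rw [norm_sub_rev (v K) (picardVec _ _ _ _ _)] at h6
      have h7 := hlip (v K)
      have h8 : ‖picardVec E M t uStarInit (v K) - v K‖ ≤ ε := hK.1
      have h9 : ‖v K - U‖ ≤ β := by
        rw [hβ, le_div_iff₀ h1ρ]
        linarith
      have h10 := mul_le_mul_of_nonneg_left h9 hρ₀.le
      -- The remainder is at most `2 * κ + ρ * β`, and `4 * κ ≤ ε`.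
      linarith
    -- In total `β ^ 2 ≤ 4 * ε ^ 2 ≤ 2 * rbar * αbar ^ 2`, while `2 * rbar ≤ 2 * A < 4 * (1 + A) ≤ R
    -- < r + 1`.
    · have h1 : ε ^ 2 ≤ rbar / 2 * αbar ^ 2 := by
        rw [← hrbar_mul]
        have : 0 ≤ rbar * αbar ^ 2 := by positivity
        linarith [mul_le_mul_of_nonneg_right hρ this]
      have h2 : 2 * rbar * αbar ^ 2 < (r + 1) * αbar ^ 2 := by
        gcongr
        linarith
      linarith
    · rw [hδβ, mul_pow, ← mul_assoc]
      refine mul_le_mul_of_nonneg_right ?_ (sq_nonneg β)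
      -- Rounding `R` down costs at most `ρ ^ 2 ≤ 1 / 4`, which the summand `1` in `R * ρ ^ 2 = 1 +
      -- A` absorbs; what is left dominates `A`, hence `q`.
      have h1 : (R - 1) * ρ ^ 2 ≤ r * ρ ^ 2 := by gcongr; linarith
      have h2 : 0 ≤ (q : ℝ) * ρ ^ 2 := by positivity
      linarith
  · obtain ⟨n, hn, hnr⟩ := hiter k hk j
    exact coe_rank_le_ofReal hn (by linarith)
  · obtain ⟨q, hqA, hq⟩ := hpic k hk
    exact coe_rank_le_ofReal (hq (t j)) (by push_cast; linarith)
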